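/- Let $\eta$ be a Poisson point process of intensity $1$ in the plane $\mathbb{R}^2$ and, for $u \in \eta$, let $C(u) = \{x \in \mathbb{R}^2 : \|u-x\|_2 \le \|v-x\|_2 \text{ for every } v \in \eta\}$ be its Voronoi cell. Given $\eta$, let $\omega \colon \eta \to \{\text{red},\text{blue}\}$ be a uniformly random two-colouring, i.e. the colours of the points are independent and each is red or blue with probability $1/2$; write $\mathbb{P}(\,\cdot \mid \eta)$ and $\mathbb{E}[\,\cdot \mid \eta]$ for probability and expectation with respect to this random colouring of the given set $\eta$. Let $R = [x_0,x_1]\times[y_0,y_1]$ with $x_0<x_1$ and $y_0<y_1$. Let $H_R$ be the event that there is a continuous path in $R$ from the left-hand to the right-hand side of $R$ that intersects only red cells. Let $X = X(\eta,\omega)$ be the maximal number of vertex-disjoint monochromatic vertical crossings of $R$: a monochromatic vertical crossing is a continuous path in $R$ from the bottom to the top side of $R$ such that all cells that it intersects have the same colour (different crossings may have different colours), and crossings are vertex-disjoint if no two of them intersect a common cell. Then, for almost every $\eta$, the event $H_R$ and the random variable $X$ are measurable with respect to the product $\sigma$-algebra on the colourings of $\eta$, the maximum defining $X$ exists for every colouring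 $\omega$, and $$\mathbb{P}\big(H_R \mid \eta\big) = \mathbb{E}\big[2^{-X} \mid \eta\big].$$ -/

import Mathlib

open MeasureTheory ProbabilityTheory

namespace Voronoi

/-- The Euclidean plane. -/
abbrev Plane : Type := EuclideanSpace ℝ (Fin 2)

/-- `η` is a homogeneous Poisson point process of intensity `1` in the plane (as a random set of
points): the number of points in a Borel set `A` of finite area is a Poisson random variable whose
mean is the area of `A`, and the numbers of points in finitely many pairwise disjoint such sets
are independent. -/
structure IsPoissonProcess {Ω : Type*} [MeasurableSpace Ω] (P : Measure Ω)
    (η : Ω → Set Plane) : Prop where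
  measurable_count : ∀ A : Set Plane, MeasurableSet A → volume A < ⊤ →
    Measurable fun w => (η w ∩ A).encard
  law_count : ∀ A : Set Plane, MeasurableSet A → volume A < ⊤ →
    P.map (fun w => (η w ∩ A).encard) =
      (poissonMeasure (volume A).toNNReal).map (fun k : ℕ => (k : ℕ∞))
  indep_count : ∀ (n : ℕ) (A : Fin n → Set Plane),
    (∀ i, MeasurableSet (A i)) → (∀ i, volume (A i) < ⊤) →
    Pairwise (fun i j => Disjoint (A i) (A j)) →
    iIndepFun (fun i w => (η w ∩ A i).encard) P

/-- The Voronoi cell of the point `u` with respect to the point set `η`. -/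
def cell (η : Set Plane) (u : Plane) : Set Plane :=
  {x | ∀ v ∈ η, ‖u - x‖ ≤ ‖v - x‖}

/-- A two-colouring of the points of `η`; `true` is red and `false` is blue. -/
abbrev Colouring (η : Set Plane) : Type := η → Bool

/-- The law of the uniformly random two-colouring of a given point set `η`: the colours of
distinct points are independent and each is red or blue with probability `1/2`. This is the
conditional law of the colouring given `η`. -/
noncomputable def colourLaw (η : Set Plane) : Measure (Colouring η) :=
  Measure.infinitePi fun _ : η => (PMF.uniformOfFintype Bool).toMeasure

/-- The rectangle `[x₀, x₁] × [y₀, y₁]`. -/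
def rect (x₀ x₁ y₀ y₁ : ℝ) : Set Plane :=
  {p | p 0 ∈ Set.Icc x₀ x₁ ∧ p 1 ∈ Set.Icc y₀ y₁}

/-- A continuous path in `[x₀, x₁] × [y₀, y₁]` from the left-hand to the right-hand side. -/
def IsHorizontalCrossing (x₀ x₁ y₀ y₁ : ℝ) (γ : C(unitInterval, Plane)) : Prop :=
  (∀ t, γ t ∈ rect x₀ x₁ y₀ y₁) ∧ γ 0 0 = x₀ ∧ γ 1 0 = x₁

/-- A continuous path in `[x₀, x₁] × [y₀, y₁]` from the bottom to the top side. -/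
def IsVerticalCrossing (x₀ x₁ y₀ y₁ : ℝ) (γ : C(unitInterval, Plane)) : Prop :=
  (∀ t, γ t ∈ rect x₀ x₁ y₀ y₁) ∧ γ 0 1 = y₀ ∧ γ 1 1 = y₁

/-- The path `γ` intersects (or touches) the Voronoi cell of `u`. -/
def Meets (η : Set Plane) (γ : C(unitInterval, Plane)) (u : η) : Prop :=
  ∃ t, γ t ∈ cell η u

/-- The path `γ` only intersects cells of colour `col`. -/
def HasColour (η : Set Plane) (ω : Colouring η) (col : Bool) (γ : C(unitInterval, Plane)) : Prop :=
  ∀ u : η, Meets η γ u → ω u = col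

/-- All cells intersected by the path `γ` have the same colour. -/
def IsMonochromatic (η : Set Plane) (ω : Colouring η) (γ : C(unitInterval, Plane)) : Prop :=
  ∃ col, HasColour η ω col γ

/-- The event `H_R`, `R = [x₀, x₁] × [y₀, y₁]`: the colourings of `η` for which there is a red
horizontal crossing of `R`. -/
def redCrossing (η : Set Plane) (x₀ x₁ y₀ y₁ : ℝ) : Set (Colouring η) :=
  {ω | ∃ γ, IsHorizontalCrossing x₀ x₁ y₀ y₁ γ ∧ HasColour η ω true γ}

/-- The set of `m` for which there are `m` vertex-disjoint monochromatic vertical crossings of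
`[x₀, x₁] × [y₀, y₁]`, where vertex-disjoint means that no two of them intersect a common cell. -/
def crossingCounts (η : Set Plane) (ω : Colouring η) (x₀ x₁ y₀ y₁ : ℝ) : Set ℕ :=
  {m | ∃ γ : Fin m → C(unitInterval, Plane),
    (∀ i, IsVerticalCrossing x₀ x₁ y₀ y₁ (γ i) ∧ IsMonochromatic η ω (γ i)) ∧
    ∀ i j, i ≠ j → ∀ u : η, ¬ (Meets η (γ i) u ∧ Meets η (γ j) u)}

/-- `X(η, ω)`: the maximal number of vertex-disjoint monochromatic vertical crossings. -/
noncomputable def maxCrossings (η : Set Plane) (x₀ x₁ y₀ y₁ : ℝ) (ω : Colouring η) : ℕ :=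
  sSup (crossingCounts η ω x₀ x₁ y₀ y₁)

end Voronoi

/-!
Let `γ` be the leftmost monochromatic vertical crossing, seen as a set of cells. Whether `γ` is
leftmost depends only on the cells that are not right of `γ`, and reversing all their colours does
not change it. Given `γ` and the colours of the cells right of `γ`, there is a blue vertical
crossing if `γ` is blue, or if there is one among the cells right of `γ`, where the colours are
still uniform; otherwise there is none. Hence, writing `p` for the probability that there is no blue
vertical crossing, `γ` contributes a factor `1 / 2` both to `p` and to `E[2⁻ˣ]`, since a maximal
disjoint family may be assumed to consist of `γ` and of crossings right of `γ`. By induction on the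
set of cells, `p = E[2⁻ˣ]`.

For a point set in general position there is no blue vertical crossing if and only if there is a red
horizontal one. Two such paths would meet, by a computation of winding numbers around the square.
Conversely, if the red cells joined to the right-hand side do not reach the left-hand side, then
some path between them and the other red cells is a blue vertical crossing.
-/

namespace Voronoi

/-! ### Crossing systems and colour switching -/

/-- `ChainTo G right T v`: a walk of the graph `G` within `T` joins `v` to the set `right`. -/
inductive ChainTo {V : Type*} (G : SimpleGraph V) (right T : Set V) : V → Prop
  | base {v : V} : v ∈ T → v ∈ right → ChainTo G right T v
  | step {v w : V} : v ∈ T → G.Adj v w → ChainTo G right T w → ChainTo G right T v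

lemma ChainTo.mem {V : Type*} {G : SimpleGraph V} {right T : Set V} {v : V}
    (h : ChainTo G right T v) : v ∈ T := by
  cases h <;> assumption

lemma ChainTo.mono {V : Type*} {G : SimpleGraph V} {right T T' : Set V} {v : V}
    (h : ChainTo G right T v) (hT : T ⊆ T') : ChainTo G right T' v := by
  induction h with
  | base hv hr => exact .base (hT hv) hr
  | step hv hadj _ ih => exact .step (hT hv) hadj ih

/-- `Separates G left right S`: every walk of `G` from `left` to `right` meets `S`. -/
def Separates {V : Type*} (G : SimpleGraph V) (left right S : Set V) : Prop :=
  ∀ v ∈ left, ¬ ChainTo G right Sᶜ v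

lemma subset_of_connected_induce {V : Type*} {G : SimpleGraph V} {s U : Set V}
    (hs : (G.induce s).Connected) (hne : (s ∩ U).Nonempty)
    (hU : ∀ v ∈ s ∩ U, ∀ w ∈ s, G.Adj w v → w ∈ U) : s ⊆ U := by
  obtain ⟨v, hvs, hvU⟩ := hne
  intro w hw
  obtain ⟨p⟩ := hs.preconnected ⟨w, hw⟩ ⟨v, hvs⟩
  suffices ∀ {a b : s} (_ : (G.induce s).Walk a b), (b : V) ∈ U → (a : V) ∈ U from this p hvU
  intro a b p hb
  induction p with
  | nil => exact hb
  | @cons a d _ had _ ih => exact hU d ⟨d.2, ih hb⟩ a a.2 had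

/-- A combinatorial model of the vertical crossings of a rectangle by cells. The vertices of
`graph` are the cells, those in `left` and `right` touch the left-hand and the right-hand side, and
`IsCrossing δ` says that `δ` is the set of cells met by a vertical crossing. The field
`separates_iff` is the duality of vertical crossings with horizontal chains of cells. -/
structure CrossingSystem (V : Type*) where
  graph : SimpleGraph V
  left : Set V
  right : Set V
  IsCrossing : Set V → Prop
  connected : ∀ {δ}, IsCrossing δ → (graph.induce δ).Connected
  separates_iff : ∀ {S}, Separates graph left right S ↔ ∃ δ, IsCrossing δ ∧ δ ⊆ S

namespace CrossingSystem

variable {V : Type*} {G : CrossingSystem V} {W U δ δ₁ δ₂ γ : Set V} {ω ω' : V → Bool} {c : Bool}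

lemma IsCrossing.nonempty (h : G.IsCrossing δ) : δ.Nonempty :=
  Set.nonempty_coe_sort.1 (G.connected h).nonempty

lemma IsCrossing.separates (h : G.IsCrossing δ) : Separates G.graph G.left G.right δ :=
  G.separates_iff.2 ⟨δ, h, subset_rfl⟩

/-- The cells joined to the right-hand side by a walk that avoids `δ`. -/
def rightOf (G : CrossingSystem V) (δ : Set V) : Set V := {v | ChainTo G.graph G.right δᶜ v}

lemma disjoint_rightOf (δ : Set V) : Disjoint δ (G.rightOf δ) :=
  Set.disjoint_left.2 fun _ hv h => h.mem hv

lemma rightOf_mono (h : Disjoint δ₁ (G.rightOf δ₂)) : G.rightOf δ₂ ⊆ G.rightOf δ₁ := by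
  intro v hv
  induction hv with
  | base hT hr => exact .base (fun hd => Set.disjoint_left.1 h hd (.base hT hr)) hr
  | step hT hr hw ih =>
    exact ChainTo.step (fun hd => Set.disjoint_left.1 h hd (ChainTo.step hT hr hw)) hr ih

lemma IsCrossing.exists_meet (h₁ : G.IsCrossing δ₁) (h₂ : G.IsCrossing δ₂) :
    ∃ δ, G.IsCrossing δ ∧ δ ⊆ δ₁ ∪ δ₂ ∧
      Disjoint δ (G.rightOf δ₁) ∧ Disjoint δ (G.rightOf δ₂) := by
  set S : Set V := {v | v ∈ δ₁ ∪ δ₂ ∧ v ∉ G.rightOf δ₁ ∧ v ∉ G.rightOf δ₂}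
  have mem_rightOf {v : V} (hv : ChainTo G.graph G.right Sᶜ v) :
      v ∈ G.rightOf δ₁ ∨ v ∈ G.rightOf δ₂ := by
    induction hv with
    | @base v hT hr =>
      by_cases hv : v ∈ δ₁ ∪ δ₂
      · by_contra hcon
        exact hT ⟨hv, not_or.1 hcon⟩
      · exact Or.inl (.base (fun h => hv (Or.inl h)) hr)
    | @step v _ hT hr _ ih =>
      by_cases hv : v ∈ δ₁ ∪ δ₂
      · by_contra hcon
        exact hT ⟨hv, not_or.1 hcon⟩
      · exact ih.imp (ChainTo.step (fun h => hv (Or.inl h)) hr)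
          (ChainTo.step (fun h => hv (Or.inr h)) hr)
  have hS : Separates G.graph G.left G.right S := fun v hv hchain =>
    (mem_rightOf hchain).elim (h₁.separates v hv) (h₂.separates v hv)
  obtain ⟨δ, hδ, hs⟩ := G.separates_iff.1 hS
  exact ⟨δ, hδ, fun v hv => (hs hv).1, Set.disjoint_left.2 fun v hv => (hs hv).2.1,
    Set.disjoint_left.2 fun v hv => (hs hv).2.2⟩

lemma IsCrossing.subset_rightOf_or_disjoint (h₁ : G.IsCrossing δ₁) (hd : Disjoint δ₁ δ₂) :
    δ₁ ⊆ G.rightOf δ₂ ∨ Disjoint δ₁ (G.rightOf δ₂) := by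
  rw [or_iff_not_imp_right, Set.not_disjoint_iff_nonempty_inter]
  exact fun hne => subset_of_connected_induce (G.connected h₁) hne fun v hv w hw hadj =>
    ChainTo.step (Set.disjoint_left.1 hd hw) hadj hv.2

lemma exists_left_chainTo_univ (G : CrossingSystem V) :
    ∃ v ∈ G.left, ChainTo G.graph G.right Set.univ v := by
  by_contra! h
  have hsep : Separates G.graph G.left G.right ∅ := by simpa [Separates] using h
  obtain ⟨δ, hδ, hs⟩ := G.separates_iff.1 hsep
  exact hδ.nonempty.ne_empty (Set.subset_empty_iff.1 hs)

lemma rightOf_ne_of_disjoint (h₁ : G.IsCrossing δ₁) (hd : Disjoint δ₁ δ₂) :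
    G.rightOf δ₁ ≠ G.rightOf δ₂ := by
  intro e
  obtain ⟨v, hv, hchain⟩ := G.exists_left_chainTo_univ
  refine h₁.separates v hv ?_
  change v ∈ G.rightOf δ₁
  clear hv
  induction hchain with
  | @base v _ hr =>
    by_cases h : v ∈ δ₁
    · rw [e]
      exact .base (Set.disjoint_left.1 hd h) hr
    · exact .base h hr
  | @step v w _ hr _ ih =>
    by_cases h : v ∈ δ₁
    · rw [e] at ih ⊢
      exact ChainTo.step (Set.disjoint_left.1 hd h) hr ih
    · exact ChainTo.step h hr ih

lemma IsCrossing.subset_rightOf_or_subset_rightOf (h₁ : G.IsCrossing δ₁) (h₂ : G.IsCrossing δ₂)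
    (hd : Disjoint δ₁ δ₂) :
    (δ₁ ⊆ G.rightOf δ₂ ∧ Disjoint δ₂ (G.rightOf δ₁)) ∨
      (δ₂ ⊆ G.rightOf δ₁ ∧ Disjoint δ₁ (G.rightOf δ₂)) := by
  rcases h₁.subset_rightOf_or_disjoint hd, h₂.subset_rightOf_or_disjoint hd.symm with
    ⟨a | a, b | b⟩
  · obtain ⟨δ, hδ, hs, hdis₁, hdis₂⟩ := h₁.exists_meet h₂
    obtain ⟨v, hv⟩ := hδ.nonempty
    exact ((hs hv).elim (fun h => Set.disjoint_left.1 hdis₂ hv (a h))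
      fun h => Set.disjoint_left.1 hdis₁ hv (b h)).elim
  · exact Or.inl ⟨a, b⟩
  · exact Or.inr ⟨b, a⟩
  · exact (rightOf_ne_of_disjoint h₁ hd ((rightOf_mono b).antisymm (rightOf_mono a))).elim

/-- `δ` is a vertical crossing contained in `W`, all of whose cells have colour `c`. -/
structure IsColoured (G : CrossingSystem V) (W : Set V) (ω : V → Bool) (c : Bool) (δ : Set V) :
    Prop where
  isCrossing : G.IsCrossing δ
  subset : δ ⊆ W
  colour_eq : ∀ v ∈ δ, ω v = c

/-- `δ` is a monochromatic vertical crossing contained in `W`. -/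
def IsMono (G : CrossingSystem V) (W : Set V) (ω : V → Bool) (δ : Set V) : Prop :=
  ∃ c, G.IsColoured W ω c δ

/-- `δ` is a leftmost monochromatic vertical crossing contained in `W`. -/
def IsLeftmost (G : CrossingSystem V) (W : Set V) (ω : V → Bool) (δ : Set V) : Prop :=
  G.IsMono W ω δ ∧ ∀ δ', G.IsMono W ω δ' → G.rightOf δ' ⊆ G.rightOf δ

/-- On the cells in `D`, the two colourings coincide or are opposite. -/
def EqUpToSwap (D : Set V) (ω ω' : V → Bool) : Prop :=
  ∃ b : Bool, ∀ v ∈ D, ω' v = xor b (ω v)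

lemma EqUpToSwap.mono {D D' : Set V} (h : EqUpToSwap D ω ω') (hD : D' ⊆ D) :
    EqUpToSwap D' ω ω' :=
  h.imp fun _ hb v hv => hb v (hD hv)

lemma EqUpToSwap.symm {D : Set V} (h : EqUpToSwap D ω ω') : EqUpToSwap D ω' ω := by
  obtain ⟨b, hb⟩ := h
  exact ⟨b, fun v hv => by simp [hb v hv]⟩

lemma IsMono.isCrossing (h : G.IsMono W ω δ) : G.IsCrossing δ := h.elim fun _ => (·.isCrossing)

lemma IsMono.subset (h : G.IsMono W ω δ) : δ ⊆ W := h.elim fun _ => (·.subset)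

lemma IsMono.subset_diff (h : G.IsMono W ω δ) : δ ⊆ W \ G.rightOf δ :=
  Set.subset_sdiff.2 ⟨h.subset, disjoint_rightOf δ⟩

lemma IsMono.of_subset {W' : Set V} (h : G.IsMono W ω δ) (hW : δ ⊆ W') : G.IsMono W' ω δ :=
  h.imp fun _ hc => ⟨hc.isCrossing, hW, hc.colour_eq⟩

lemma IsMono.of_eqUpToSwap (h : G.IsMono W ω δ) (hω : EqUpToSwap δ ω ω') : G.IsMono W ω' δ := by
  obtain ⟨c, hc⟩ := h
  obtain ⟨b, hb⟩ := hω
  exact ⟨xor b c, hc.isCrossing, hc.subset, fun v hv => by rw [hb v hv, hc.colour_eq v hv]⟩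

lemma exists_isLeftmost [Finite V] (h : ∃ δ, G.IsMono W ω δ) : ∃ δ, G.IsLeftmost W ω δ := by
  obtain ⟨γ, hγ, hmax⟩ :=
    Set.Finite.exists_maximalFor G.rightOf {δ | G.IsMono W ω δ} (Set.toFinite _) h
  refine ⟨γ, hγ, fun δ hδ => ?_⟩
  by_cases hdis : Disjoint γ δ
  · rcases hγ.isCrossing.subset_rightOf_or_subset_rightOf hδ.isCrossing hdis with
      ⟨_, h⟩ | ⟨_, h⟩
    · exact hmax hδ (rightOf_mono h)
    · exact rightOf_mono h
  · obtain ⟨v, hvγ, hvδ⟩ := Set.not_disjoint_iff.1 hdis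
    obtain ⟨c, hc⟩ := hγ
    obtain ⟨d, hd⟩ := hδ
    obtain rfl : c = d := (hc.colour_eq v hvγ).symm.trans (hd.colour_eq v hvδ)
    obtain ⟨ε, hε, hs, hdis₁, hdis₂⟩ := hc.isCrossing.exists_meet hd.isCrossing
    have hεm : G.IsMono W ω ε := ⟨c, hε, hs.trans (Set.union_subset hc.subset hd.subset),
      fun v hv => (hs hv).elim (hc.colour_eq v) (hd.colour_eq v)⟩
    exact (rightOf_mono hdis₂).trans (hmax hεm (rightOf_mono hdis₁))

lemma IsLeftmost.of_eqUpToSwap [Finite V] (h : G.IsLeftmost W ω γ)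
    (hω : EqUpToSwap (W \ G.rightOf γ) ω ω') : G.IsLeftmost W ω' γ := by
  have hγ : G.IsMono W ω' γ := h.1.of_eqUpToSwap (hω.mono h.1.subset_diff)
  obtain ⟨γ', hγ', hleft⟩ := exists_isLeftmost ⟨γ, hγ⟩
  have hsub : γ' ⊆ W \ G.rightOf γ :=
    hγ'.subset_diff.trans (Set.sdiff_subset_sdiff_right (hleft γ hγ))
  have hγ'ω : G.IsMono W ω γ' := hγ'.of_eqUpToSwap (hω.mono hsub).symm
  exact ⟨hγ, fun δ hδ => (hleft δ hδ).trans (h.2 γ' hγ'ω)⟩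

/-- The numbers of disjoint monochromatic vertical crossings contained in `W`. -/
def counts (G : CrossingSystem V) (W : Set V) (ω : V → Bool) : Set ℕ :=
  {m | ∃ δ : Fin m → Set V, (∀ i, G.IsMono W ω (δ i)) ∧ Pairwise fun i j => Disjoint (δ i) (δ j)}

/-- The maximal number of disjoint monochromatic vertical crossings contained in `W`. -/
noncomputable def maxCount (G : CrossingSystem V) (W : Set V) (ω : V → Bool) : ℕ :=
  sSup (G.counts W ω)

lemma zero_mem_counts (W : Set V) (ω : V → Bool) : 0 ∈ G.counts W ω :=
  ⟨Fin.elim0, fun i => i.elim0, fun i => i.elim0⟩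

lemma le_card_of_mem_counts [Finite V] {m : ℕ} (hm : m ∈ G.counts W ω) : m ≤ Nat.card V := by
  obtain ⟨δ, hδ, hd⟩ := hm
  choose x hx using fun i => (hδ i).isCrossing.nonempty
  have hinj : Function.Injective x := fun i j hij => by
    by_contra hne
    exact Set.disjoint_left.1 (hd hne) (hx i) (hij ▸ hx j)
  simpa using Nat.card_le_card_of_injective x hinj

lemma isGreatest_maxCount [Finite V] (W : Set V) (ω : V → Bool) :
    IsGreatest (G.counts W ω) (G.maxCount W ω) := by
  have hb : BddAbove (G.counts W ω) := ⟨_, fun m => le_card_of_mem_counts⟩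
  exact ⟨Nat.sSup_mem ⟨0, zero_mem_counts W ω⟩ hb, fun m hm => le_csSup hb hm⟩

lemma maxCount_eq_zero [Finite V] (h : ∀ δ, ¬ G.IsMono W ω δ) : G.maxCount W ω = 0 := by
  obtain ⟨δ, hδ, -⟩ := (isGreatest_maxCount (G := G) W ω).1
  by_contra hne
  exact h _ (hδ ⟨0, Nat.pos_of_ne_zero hne⟩)

lemma IsLeftmost.succ_mem_counts (h : G.IsLeftmost W ω γ) {m : ℕ}
    (hm : m ∈ G.counts (W ∩ G.rightOf γ) ω) : m + 1 ∈ G.counts W ω := by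
  obtain ⟨δ, hδ, hd⟩ := hm
  have hγ (i) : Disjoint γ (δ i) :=
    (disjoint_rightOf γ).mono_right ((hδ i).subset.trans Set.inter_subset_right)
  refine ⟨Fin.cons γ δ, Fin.cases h.1 fun i =>
    (hδ i).of_subset ((hδ i).subset.trans Set.inter_subset_left), ?_⟩
  refine Fin.cases (Fin.cases (fun h => (h rfl).elim) fun j _ => hγ j) fun i =>
    Fin.cases (fun _ => (hγ i).symm) fun j hij => hd fun e => hij (congrArg _ e)

lemma IsLeftmost.pred_mem_counts (h : G.IsLeftmost W ω γ) {m : ℕ}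
    (hm : m + 1 ∈ G.counts W ω) : m ∈ G.counts (W ∩ G.rightOf γ) ω := by
  obtain ⟨δ, hδ, hd⟩ := hm
  obtain ⟨i, hi⟩ : ∃ i, ∀ j ≠ i, δ j ⊆ G.rightOf γ := by
    by_cases hall : ∀ i, δ i ⊆ G.rightOf γ
    · exact ⟨0, fun j _ => hall j⟩
    obtain ⟨i, hi⟩ := not_forall.1 hall
    refine ⟨i, fun j hj => ?_⟩
    rcases (hδ i).isCrossing.subset_rightOf_or_subset_rightOf (hδ j).isCrossing (hd hj.symm) with
      ⟨hij, _⟩ | ⟨hji, _⟩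
    · exact (hi (hij.trans (h.2 _ (hδ j)))).elim
    · exact hji.trans (h.2 _ (hδ i))
  exact ⟨fun j => δ (i.succAbove j),
    fun j => (hδ _).of_subset (Set.subset_inter (hδ _).subset (hi _ (Fin.succAbove_ne i j))),
    fun j k hjk => hd (Fin.succAbove_right_injective.ne hjk)⟩

lemma IsLeftmost.maxCount_eq_add_one [Finite V] (h : G.IsLeftmost W ω γ) :
    G.maxCount W ω = G.maxCount (W ∩ G.rightOf γ) ω + 1 := by
  refine (isGreatest_maxCount W ω).unique ⟨h.succ_mem_counts (isGreatest_maxCount _ ω).1, ?_⟩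
  rintro (_ | m) hm
  · exact Nat.zero_le _
  · exact Nat.succ_le_succ ((isGreatest_maxCount _ ω).2 (h.pred_mem_counts hm))

/-- There is no vertical crossing of colour `c` in `W`. -/
def NoCrossing (G : CrossingSystem V) (W : Set V) (c : Bool) (ω : V → Bool) : Prop :=
  ∀ δ, ¬ G.IsColoured W ω c δ

lemma NoCrossing.anti {W' : Set V} (h : G.NoCrossing W c ω) (hW : W' ⊆ W) : G.NoCrossing W' c ω :=
  fun δ hδ => h δ ⟨hδ.isCrossing, hδ.subset.trans hW, hδ.colour_eq⟩

lemma NoCrossing.congr (h : G.NoCrossing W c ω) (hω : ∀ v ∈ W, ω v = ω' v) :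
    G.NoCrossing W c ω' :=
  fun δ hδ => h δ ⟨hδ.isCrossing, hδ.subset, fun v hv =>
    (hω v (hδ.subset hv)).trans (hδ.colour_eq v hv)⟩

lemma IsLeftmost.noCrossing_iff (h : G.IsLeftmost W ω γ)
    (hU : G.NoCrossing (W ∩ G.rightOf γ) c ω) :
    G.NoCrossing W c ω ↔ ∀ v ∈ γ, ω v = !c := by
  obtain ⟨d, hd⟩ := h.1
  constructor
  · intro hn v hv
    rw [hd.colour_eq v hv]
    exact Bool.eq_not_of_ne fun e => hn γ (e ▸ hd)
  · intro hγ δ hδ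
    have hdis : Disjoint γ δ := Set.disjoint_left.2 fun v hvγ hvδ =>
      Bool.eq_not.1 (hγ v hvγ) (hδ.colour_eq v hvδ)
    rcases hd.isCrossing.subset_rightOf_or_subset_rightOf hδ.isCrossing hdis with
      ⟨hγδ, _⟩ | ⟨hδγ, _⟩
    · obtain ⟨v, hv⟩ := hd.isCrossing.nonempty
      exact (disjoint_rightOf γ).notMem_of_mem_left hv (h.2 δ ⟨c, hδ⟩ (hγδ hv))
    · exact hU δ ⟨hδ.isCrossing, Set.subset_inter hδ.subset hδγ, hδ.colour_eq⟩

open scoped Classical in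
/-- The colouring `ω` with the colours in `D` swapped. -/
noncomputable def swapOn (D : Set V) (ω : V → Bool) : V → Bool :=
  D.piecewise (fun v => !ω v) ω

open scoped Classical in
lemma swapOn_of_mem {D : Set V} {v : V} (hv : v ∈ D) : swapOn D ω v = !ω v :=
  Set.piecewise_eq_of_mem _ _ _ hv

open scoped Classical in
lemma swapOn_of_notMem {D : Set V} {v : V} (hv : v ∉ D) : swapOn D ω v = ω v :=
  Set.piecewise_eq_of_notMem _ _ _ hv

lemma swapOn_swapOn (D : Set V) (ω : V → Bool) : swapOn D (swapOn D ω) = ω := by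
  funext v
  by_cases hv : v ∈ D <;> simp [swapOn, hv]

lemma eqUpToSwap_swapOn (D : Set V) (ω : V → Bool) : EqUpToSwap D ω (swapOn D ω) :=
  ⟨true, fun v hv => by simp [swapOn_of_mem hv]⟩

/-- The colourings for which the cells right of a leftmost monochromatic vertical crossing contained
in `W` form the set `U`. -/
def leftmostFibre (G : CrossingSystem V) (W U : Set V) : Set (V → Bool) :=
  {ω | ∃ γ, G.IsLeftmost W ω γ ∧ G.rightOf γ = U}

lemma inter_ssubset_of_mem_leftmostFibre (h : ω ∈ G.leftmostFibre W U) : W ∩ U ⊂ W := by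
  obtain ⟨γ, hγ, rfl⟩ := h
  obtain ⟨v, hv⟩ := hγ.1.isCrossing.nonempty
  exact Set.inter_ssubset_left_iff.2 fun hW => (hγ.1.subset_diff hv).2 (hW (hγ.1.subset hv))

lemma mem_leftmostFibre_of_eqUpToSwap [Finite V] (h : ω ∈ G.leftmostFibre W U)
    (hω : EqUpToSwap (W \ U) ω ω') : ω' ∈ G.leftmostFibre W U := by
  obtain ⟨γ, hγ, rfl⟩ := h
  exact ⟨γ, hγ.of_eqUpToSwap hω, rfl⟩

lemma noCrossing_swapOn_iff [Finite V] (h : ω ∈ G.leftmostFibre W U)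
    (hU : G.NoCrossing (W ∩ U) c ω) :
    G.NoCrossing W c (swapOn (W \ U) ω) ↔ ¬ G.NoCrossing W c ω := by
  obtain ⟨γ, hγ, rfl⟩ := h
  have hγ' := hγ.of_eqUpToSwap (eqUpToSwap_swapOn _ _)
  have hU' : G.NoCrossing (W ∩ G.rightOf γ) c (swapOn (W \ G.rightOf γ) ω) :=
    hU.congr fun v hv => (swapOn_of_notMem fun hv' => hv'.2 hv.2).symm
  rw [hγ'.noCrossing_iff hU', hγ.noCrossing_iff hU]
  obtain ⟨d, hd⟩ := hγ.1
  obtain ⟨v, hv⟩ := hd.isCrossing.nonempty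
  have hswap : ∀ v ∈ γ, swapOn (W \ G.rightOf γ) ω v = !d := fun v hv => by
    rw [swapOn_of_mem (hγ.1.subset_diff hv), hd.colour_eq v hv]
  constructor
  · intro h h'
    simpa [← h' v hv, hd.colour_eq v hv, hswap v hv] using h v hv
  · intro h u hu
    rw [hswap u hu, Bool.not_inj_iff]
    by_contra hdc
    exact h fun u hu => (hd.colour_eq u hu).trans (Bool.eq_not_of_ne hdc)

lemma swapOn_mem_of_dependsOn {E : Finset (V → Bool)} (hE : DependsOn (· ∈ E) Wᶜ) (hω : ω ∈ E) :
    swapOn (W \ U) ω ∈ E :=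
  (hE fun _ hv => (swapOn_of_notMem fun h => hv h.1).symm).mp hω

open scoped Classical in
lemma two_mul_card_noCrossing [Finite V] {E : Finset (V → Bool)} (hE : DependsOn (· ∈ E) Wᶜ)
    (U : Set V) (c : Bool) :
    2 * Finset.card {ω ∈ E | ω ∈ G.leftmostFibre W U ∧ G.NoCrossing W c ω} =
      Finset.card {ω ∈ E | ω ∈ G.leftmostFibre W U ∧ G.NoCrossing (W ∩ U) c ω} := by
  set E' : Finset (V → Bool) :=
    {ω ∈ E | ω ∈ G.leftmostFibre W U ∧ G.NoCrossing (W ∩ U) c ω} with hE'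
  have hswap : ∀ ω ∈ E', swapOn (W \ U) ω ∈ E' := fun ω hω => by
    obtain ⟨hωE, hωU, hωc⟩ := Finset.mem_filter.1 hω
    exact Finset.mem_filter.2 ⟨swapOn_mem_of_dependsOn hE hωE,
      mem_leftmostFibre_of_eqUpToSwap hωU (eqUpToSwap_swapOn _ _),
      hωc.congr fun v hv => (swapOn_of_notMem fun hv' => hv'.2 hv.2).symm⟩
  have hiff : ∀ ω ∈ E', G.NoCrossing W c (swapOn (W \ U) ω) ↔ ¬ G.NoCrossing W c ω :=
    fun ω hω => noCrossing_swapOn_iff (Finset.mem_filter.1 hω).2.1 (Finset.mem_filter.1 hω).2.2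
  have hcard : Finset.card {ω ∈ E' | G.NoCrossing W c ω} =
      Finset.card {ω ∈ E' | ¬ G.NoCrossing W c ω} := by
    refine Finset.card_nbij' (swapOn (W \ U)) (swapOn (W \ U)) ?_ ?_
      (fun _ _ => swapOn_swapOn _ _) fun _ _ => swapOn_swapOn _ _ <;>
    · intro ω hω
      simp only [Finset.coe_filter, Set.mem_ofPred_eq] at hω ⊢
      exact ⟨hswap ω hω.1, by simp [hiff ω hω.1, hω.2]⟩
  have hsub : ({ω ∈ E | ω ∈ G.leftmostFibre W U ∧ G.NoCrossing W c ω} : Finset (V → Bool)) =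
      {ω ∈ E' | G.NoCrossing W c ω} := by
    rw [hE', Finset.filter_filter]
    refine Finset.filter_congr fun ω _ => ⟨fun h => ⟨⟨h.1, h.2.anti Set.inter_subset_left⟩, h.2⟩,
      fun h => ⟨h.1.1, h.2⟩⟩
  rw [hsub, two_mul, ← Finset.card_filter_add_card_filter_not (s := E') (G.NoCrossing W c), ← hcard]

/-- The cells right of some monochromatic vertical crossing contained in `W`. -/
def rightPart (G : CrossingSystem V) (W : Set V) (ω : V → Bool) : Set V :=
  ⋃ (δ) (_ : G.IsMono W ω δ), G.rightOf δ

lemma IsLeftmost.rightPart_eq (h : G.IsLeftmost W ω γ) : G.rightPart W ω = G.rightOf γ :=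
  (Set.iUnion₂_subset h.2).antisymm (Set.subset_iUnion₂_of_subset γ h.1 subset_rfl)

lemma mem_leftmostFibre_iff [Finite V] :
    ω ∈ G.leftmostFibre W U ↔ (∃ δ, G.IsMono W ω δ) ∧ G.rightPart W ω = U := by
  constructor
  · rintro ⟨γ, hγ, rfl⟩
    exact ⟨⟨γ, hγ.1⟩, hγ.rightPart_eq⟩
  · rintro ⟨h, rfl⟩
    obtain ⟨γ, hγ⟩ := exists_isLeftmost h
    exact ⟨γ, hγ, hγ.rightPart_eq.symm⟩

open scoped Classical in
lemma sum_eq_sum_leftmostFibre [Fintype V] (G : CrossingSystem V) (W : Set V)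
    (E : Finset (V → Bool)) (f : (V → Bool) → ℝ) :
    ∑ ω ∈ E, f ω = ∑ ω ∈ E with ∀ δ, ¬ G.IsMono W ω δ, f ω +
      ∑ U : Set V, ∑ ω ∈ E with ω ∈ G.leftmostFibre W U, f ω := by
  have hfiber := Finset.sum_fiberwise {ω ∈ E | ∃ δ, G.IsMono W ω δ} (G.rightPart W) f
  simp_rw [Finset.filter_filter, ← mem_leftmostFibre_iff] at hfiber
  rw [hfiber, add_comm]
  simp_rw [← not_exists]
  exact (Finset.sum_filter_add_sum_filter_not E _ f).symm

open scoped Classical in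
lemma dependsOn_filter_leftmostFibre [Finite V] {E : Finset (V → Bool)}
    (hE : DependsOn (· ∈ E) Wᶜ) (U : Set V) :
    DependsOn (· ∈ ({ω ∈ E | ω ∈ G.leftmostFibre W U} : Finset (V → Bool))) (W ∩ U)ᶜ := by
  suffices ∀ ω ω' : V → Bool, (∀ v ∈ (W ∩ U)ᶜ, ω v = ω' v) → ω ∈ E ∧ ω ∈ G.leftmostFibre W U →
      ω' ∈ E ∧ ω' ∈ G.leftmostFibre W U by
    intro ω ω' h
    simp only [Finset.mem_filter]
    exact propext ⟨this ω ω' h, this ω' ω fun v hv => (h v hv).symm⟩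
  rintro ω ω' h ⟨hωE, hωU⟩
  refine ⟨(hE fun v hv => h v fun h' => hv h'.1).mp hωE, mem_leftmostFibre_of_eqUpToSwap hωU ?_⟩
  exact ⟨false, fun v hv => by simp [h v fun h' => hv.2 h'.2]⟩

open scoped Classical in
theorem card_noCrossing_eq_sum [Finite V] (G : CrossingSystem V) (c : Bool) (W : Set V) :
    ∀ E : Finset (V → Bool), DependsOn (· ∈ E) Wᶜ →
      (Finset.card {ω ∈ E | G.NoCrossing W c ω} : ℝ) = ∑ ω ∈ E, (1 / 2) ^ G.maxCount W ω := by
  have := Fintype.ofFinite V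
  induction W using WellFoundedLT.induction with | ind W ih => ?_
  intro E hE
  rw [Finset.natCast_card_filter, sum_eq_sum_leftmostFibre G W,
    sum_eq_sum_leftmostFibre G W E fun ω => (1 / 2) ^ G.maxCount W ω]
  refine congrArg₂ (· + ·) (Finset.sum_congr rfl fun ω hω => ?_)
    (Finset.sum_congr rfl fun U _ => ?_)
  · have hno : ∀ δ, ¬ G.IsMono W ω δ := (Finset.mem_filter.1 hω).2
    have hnoc : G.NoCrossing W c ω := fun δ hδ => hno δ ⟨c, hδ⟩
    rw [if_pos hnoc, maxCount_eq_zero hno, pow_zero]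
  set E' : Finset (V → Bool) := {ω ∈ E | ω ∈ G.leftmostFibre W U}
  rcases E'.eq_empty_or_nonempty with hempty | ⟨ω₀, hω₀⟩
  · simp [hempty]
  calc ∑ ω ∈ E', (if G.NoCrossing W c ω then (1 : ℝ) else 0)
      = Finset.card {ω ∈ E | ω ∈ G.leftmostFibre W U ∧ G.NoCrossing W c ω} := by
        rw [← Finset.natCast_card_filter, Finset.filter_filter]
    _ = 1 / 2 * Finset.card {ω ∈ E' | G.NoCrossing (W ∩ U) c ω} := by
        rw [Finset.filter_filter, ← two_mul_card_noCrossing hE]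
        push_cast
        ring
    _ = 1 / 2 * ∑ ω ∈ E', (1 / 2) ^ G.maxCount (W ∩ U) ω := by
        rw [ih _ (inter_ssubset_of_mem_leftmostFibre (Finset.mem_filter.1 hω₀).2) E'
          (dependsOn_filter_leftmostFibre hE U)]
    _ = ∑ ω ∈ E', (1 / 2) ^ G.maxCount W ω := by
        rw [Finset.mul_sum]
        refine Finset.sum_congr rfl fun ω hω => ?_
        obtain ⟨γ, hγ, rfl⟩ := (Finset.mem_filter.1 hω).2
        rw [hγ.maxCount_eq_add_one, pow_succ']

end CrossingSystem

/-! ### Crossing paths in a square -/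

section Topology

open Complex Topology
open scoped unitInterval

instance contractibleSpace_unitInterval : ContractibleSpace I :=
  (convex_Icc (0 : ℝ) 1).contractibleSpace ⟨0, by simp⟩

instance locallyPathConnectedSpace_unitInterval : LocallyPathConnectedSpace I :=
  (convex_Icc (0 : ℝ) 1).locallyPathConnectedSpace

lemma exists_continuous_exp_eq {X : Type*} [TopologicalSpace X] [SimplyConnectedSpace X]
    [LocallyPathConnectedSpace X] {g : X → ℂ} (hg : Continuous g) (h0 : ∀ x, g x ≠ 0) :
    ∃ f : X → ℂ, Continuous f ∧ ∀ x, exp (f x) = g x := by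
  obtain ⟨x₀⟩ := (inferInstance : Nonempty X)
  obtain ⟨f, ⟨-, hf⟩, -⟩ :=
    isCoveringMapOn_exp.existsUnique_continuousMap_lifts ⟨g, hg⟩ (exp_log (h0 x₀)) h0
  exact ⟨f, f.continuous, congrFun hf⟩

section Preconnected

variable {X : Type*} [TopologicalSpace X] [PreconnectedSpace X] {f g : X → ℂ}

lemma sub_eq_sub_of_exp_eq_mul_exp (hf : Continuous f) (hg : Continuous g) {c : ℂ}
    (h : ∀ x, exp (f x) = c * exp (g x)) (a b : X) : f b - f a = g b - g a := by
  have hc : c * exp (g a) = exp (f a) := (h a).symm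
  have hlift : f = fun x => g x + (f a - g a) := by
    refine isCoveringMap_exp.eq_of_comp_eq hf (by fun_prop) ?_ a (by ring)
    funext x
    simp only [Function.comp_apply, Subtype.mk.injEq]
    rw [h x, Complex.exp_add, Complex.exp_sub, ← hc]
    field_simp
  rw [congrFun hlift b]
  ring

lemma sub_eq_log_sub_log (hf : Continuous f) {c : ℂ} (hc : c ≠ 0)
    (hre : ∀ x, 0 ≤ (c * exp (f x)).re) (a b : X) :
    f b - f a = log (c * exp (f b)) - log (c * exp (f a)) := by
  have hne (x : X) : c * exp (f x) ≠ 0 := mul_ne_zero hc (exp_ne_zero _)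
  have hslit (x : X) : c * exp (f x) ∈ slitPlane := by
    rcases (hre x).eq_or_lt with h | h
    · exact Or.inr fun him => hne x (Complex.ext h.symm him)
    · exact Or.inl h
  refine (sub_eq_sub_of_exp_eq_mul_exp (Continuous.clog (by fun_prop) hslit) hf (c := c)
    (fun x => exp_log (hne x)) a b).symm

end Preconnected

lemma log_neg_I_mul {z : ℂ} (hz : z ≠ 0) (hre : 0 ≤ z.re) (him : 0 ≤ z.im) :
    log (-Complex.I * z) = log z - Real.pi / 2 * Complex.I := by
  have harg : z.arg ≤ Real.pi / 2 := arg_le_pi_div_two_iff.2 (Or.inl hre)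
  have hsum : arg (-Complex.I) + z.arg ∈ Set.Ioc (-Real.pi) Real.pi := by
    rw [arg_neg_I]
    constructor <;> linarith [Real.pi_pos, arg_nonneg_iff.2 him]
  rw [(log_mul_eq_add_log_iff (neg_ne_zero.2 I_ne_zero) hz).2 hsum, log_neg_I]
  ring

/-- Otherwise, going once around the square, the argument of `F` decreases by `π / 2` on average
per side, whereas `F` has a continuous logarithm. -/
lemma exists_eq_zero_of_square {F : I × I → ℂ} (hF : Continuous F)
    (hbot : ∀ s, 0 ≤ (F (s, 0)).im) (hright : ∀ t, 0 ≤ (F (1, t)).re)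
    (htop : ∀ s, (F (s, 1)).im ≤ 0) (hleft : ∀ t, (F (0, t)).re ≤ 0) :
    ∃ z, F z = 0 := by
  by_contra! hne
  obtain ⟨f, hf, hfe⟩ := exists_continuous_exp_eq hF hne
  have bottom := sub_eq_log_sub_log (f := fun s => f (s, 0)) (by fun_prop)
    (neg_ne_zero.2 I_ne_zero) (fun s => by simpa [hfe] using hbot s) 0 1
  have right := sub_eq_log_sub_log (f := fun t => f (1, t)) (by fun_prop)
    one_ne_zero (fun t => by simpa [hfe] using hright t) 0 1
  have top := sub_eq_log_sub_log (f := fun s => f (s, 1)) (by fun_prop)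
    I_ne_zero (fun s => by simpa [hfe] using htop s) 1 0
  have left := sub_eq_log_sub_log (f := fun t => f (0, t)) (by fun_prop)
    (neg_ne_zero.2 one_ne_zero) (fun t => by simpa [hfe] using hleft t) 1 0
  have corner₁ := log_neg_I_mul (hne (1, 0)) (hright 0) (hbot 1)
  have corner₂ := log_neg_I_mul (mul_ne_zero I_ne_zero (hne (1, 1)))
    (by simpa using htop 1) (by simpa using hright 1)
  have corner₃ := log_neg_I_mul (neg_ne_zero.2 (hne (0, 1)))
    (by simpa using hleft 1) (by simpa using htop 0)
  have corner₄ := log_neg_I_mul (mul_ne_zero (neg_ne_zero.2 I_ne_zero) (hne (0, 0)))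
    (by simpa using hbot 0) (by simpa using hleft 0)
  simp only [hfe, neg_mul, mul_neg, one_mul, ← mul_assoc, I_mul_I, neg_neg]
    at bottom right top left corner₁ corner₂ corner₃ corner₄
  refine two_pi_I_ne_zero ?_
  linear_combination bottom + right + top + left + corner₁ + corner₂ + corner₃ + corner₄

lemma exp_mul_pi_mul_I_eq_exp_neg {r : ℝ} (hr : r = 0 ∨ r = 1) :
    exp (r * Real.pi * Complex.I) = exp (-(r * Real.pi * Complex.I)) := by
  rcases hr with rfl | rfl <;> simp [Complex.exp_neg, exp_pi_mul_I]

open scoped Classical in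
/-- A function `h` that increases from `0` to `1` across the square takes another value on the
frontier of every set that separates the bottom from the top where `0 < h < 1`: otherwise
`exp (π i h)` inside and `exp (-π i h)` outside glue to a function with no logarithm. -/
lemma exists_mem_frontier_of_square {h : I × I → ℝ} (hh : Continuous h) {A : Set (I × I)}
    (hleft : ∀ t, h (0, t) = 0) (hright : ∀ t, h (1, t) = 1)
    (hbot : ∀ s, (s, 0) ∉ A → h (s, 0) = 0 ∨ h (s, 0) = 1) (htop : ∀ s, (s, 1) ∉ A) :
    ∃ z ∈ frontier A, ¬ (h z = 0 ∨ h z = 1) := by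
  by_contra! hA
  set g : I × I → ℂ := fun z =>
    if z ∈ A then exp (h z * Real.pi * Complex.I) else exp (-(h z * Real.pi * Complex.I))
  have hg : Continuous g := Continuous.if (fun z hz => exp_mul_pi_mul_I_eq_exp_neg (hA z hz))
    (by fun_prop) (by fun_prop)
  have hg0 (z) : g z ≠ 0 := by
    simp only [g]
    split_ifs <;> exact exp_ne_zero _
  obtain ⟨f, hf, hfe⟩ := exists_continuous_exp_eq hg hg0
  have bottom := sub_eq_sub_of_exp_eq_mul_exp (c := 1) (f := fun s => f (s, 0))
    (g := fun s => h (s, 0) * Real.pi * Complex.I) (by fun_prop) (by fun_prop) (fun s => by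
      rw [hfe, one_mul]
      by_cases hs : (s, 0) ∈ A
      · exact if_pos hs
      · exact (if_neg hs).trans (exp_mul_pi_mul_I_eq_exp_neg (hbot s hs)).symm) 0 1
  have top := sub_eq_sub_of_exp_eq_mul_exp (c := 1) (f := fun s => f (s, 1))
    (g := fun s => -(h (s, 1) * Real.pi * Complex.I)) (by fun_prop) (by fun_prop)
    (fun s => by rw [hfe, one_mul]; exact if_neg (htop s)) 0 1
  have left := sub_eq_sub_of_exp_eq_mul_exp (c := 1) (f := fun t => f (0, t))
    (g := fun _ => 0) (by fun_prop) (by fun_prop) (fun t => by simp [hfe, g, hleft]) 0 1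
  have right := sub_eq_sub_of_exp_eq_mul_exp (c := -1) (f := fun t => f (1, t))
    (g := fun _ => 0) (by fun_prop) (by fun_prop)
    (fun t => by simp [hfe, g, hright, Complex.exp_neg, exp_pi_mul_I]) 0 1
  simp only [hleft, hright, ofReal_zero, ofReal_one, zero_mul, one_mul, sub_zero, neg_zero]
    at bottom top left right
  refine two_pi_I_ne_zero ?_
  linear_combination -bottom + top + left - right

lemma disjoint_frontier_of_pathComponents {X : Type*} [TopologicalSpace X]
    [LocallyPathConnectedSpace X] {U : Set X} (hU : IsOpen U) (B : Set X) :
    Disjoint U (frontier {x | ∃ b ∈ B, JoinedIn U b x}) := by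
  set A : Set X := {x | ∃ b ∈ B, JoinedIn U b x}
  refine Set.disjoint_left.2 fun x hx hfr => ?_
  have hnhds : pathComponentIn U x ∈ 𝓝 x := pathComponentIn_mem_nhds (hU.mem_nhds hx)
  obtain ⟨y, hyx, b, hb, hby⟩ := mem_closure_iff_nhds.1 hfr.1 _ hnhds
  refine hfr.2 (mem_interior_iff_mem_nhds.2 ?_)
  filter_upwards [hnhds] with z hz
  exact ⟨b, hb, hby.trans (hyx.symm.trans hz)⟩

lemma exists_joinedIn_of_square {K₁ K₂ : Set (I × I)} (h₁ : IsClosed K₁) (h₂ : IsClosed K₂)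
    (hdis : Disjoint K₁ K₂) (hright : ∀ t, (1, t) ∉ K₁) (hleft : ∀ t, (0, t) ∉ K₂) :
    ∃ s s', JoinedIn (K₁ ∪ K₂)ᶜ (s, 0) (s', 1) := by
  set L : Set (I × I) := {z | z.1 = 0}
  set R : Set (I × I) := {z | z.1 = 1}
  have hL : IsClosed L := isClosed_eq continuous_fst continuous_const
  have hR : IsClosed R := isClosed_eq continuous_fst continuous_const
  have hdisLR : Disjoint (K₁ ∪ L) (K₂ ∪ R) := by
    simp only [Set.disjoint_union_left, Set.disjoint_union_right]
    refine ⟨⟨hdis, ?_⟩, ?_, ?_⟩ <;> rw [Set.disjoint_left]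
    · rintro ⟨s, t⟩ (rfl : s = 0) hz
      exact hleft t hz
    · rintro ⟨s, t⟩ hz (rfl : s = 1)
      exact hright t hz
    · rintro z hz0 hz1
      exact zero_ne_one (hz0.symm.trans hz1)
  obtain ⟨h, h0, h1, -⟩ := exists_continuous_zero_one_of_isClosed (h₁.union hL) (h₂.union hR) hdisLR
  have hK {z : I × I} (hz : z ∈ K₁ ∪ K₂) : h z = 0 ∨ h z = 1 :=
    hz.imp (fun hz => h0 (Or.inl hz)) fun hz => h1 (Or.inl hz)
  by_contra! hcon
  set A : Set (I × I) := {z | ∃ b ∈ {z : I × I | z.2 = 0}, JoinedIn (K₁ ∪ K₂)ᶜ b z}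
  have hbot (s : I) (hs : (s, 0) ∉ A) : h (s, 0) = 0 ∨ h (s, 0) = 1 :=
    hK (by_contra fun hsK => hs ⟨(s, 0), rfl, JoinedIn.refl hsK⟩)
  have htop (s : I) : (s, 1) ∉ A := by
    rintro ⟨⟨s', t'⟩, (rfl : t' = 0), hj⟩
    exact hcon s' s hj
  obtain ⟨z, hz, hhz⟩ := exists_mem_frontier_of_square h.continuous (fun t => h0 (Or.inr rfl))
    (fun t => h1 (Or.inr rfl)) hbot htop
  exact (disjoint_frontier_of_pathComponents (h₁.union h₂).isOpen_compl _).notMem_of_mem_left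
    (fun hzK => hhz (hK hzK)) hz

lemma exists_eq_of_crossings {x₀ x₁ y₀ y₁ : ℝ} {γ δ : C(I, Plane)}
    (hγ : IsHorizontalCrossing x₀ x₁ y₀ y₁ γ) (hδ : IsVerticalCrossing x₀ x₁ y₀ y₁ δ) :
    ∃ s t, γ s = δ t := by
  set F : I × I → ℂ := fun z =>
    ((γ z.1 0 - δ z.2 0 : ℝ) : ℂ) + ((γ z.1 1 - δ z.2 1 : ℝ) : ℂ) * Complex.I
  have hre (z) : (F z).re = γ z.1 0 - δ z.2 0 := by simp [F]
  have him (z) : (F z).im = γ z.1 1 - δ z.2 1 := by simp [F]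
  obtain ⟨⟨s, t⟩, hz⟩ := exists_eq_zero_of_square (F := F) (by fun_prop)
    (fun s => by rw [him, hδ.2.1, sub_nonneg]; exact (hγ.1 s).2.1)
    (fun t => by rw [hre, hγ.2.2, sub_nonneg]; exact (hδ.1 t).1.2)
    (fun s => by rw [him, hδ.2.2, sub_nonpos]; exact (hγ.1 s).2.2)
    (fun t => by rw [hre, hγ.2.1, sub_nonpos]; exact (hδ.1 t).1.1)
  refine ⟨s, t, ?_⟩
  ext i
  fin_cases i
  · exact sub_eq_zero.1 ((hre (s, t)).symm.trans (by rw [hz, zero_re]))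
  · exact sub_eq_zero.1 ((him (s, t)).symm.trans (by rw [hz, zero_im]))

lemma convex_rect (x₀ x₁ y₀ y₁ : ℝ) : Convex ℝ (rect x₀ x₁ y₀ y₁) :=
  ((convex_Icc x₀ x₁).is_linear_preimage (f := fun p : Plane => p 0) ⟨by simp, by simp⟩).inter
    ((convex_Icc y₀ y₁).is_linear_preimage (f := fun p : Plane => p 1) ⟨by simp, by simp⟩)

lemma isCompact_rect (x₀ x₁ y₀ y₁ : ℝ) : IsCompact (rect x₀ x₁ y₀ y₁) := by
  convert! (EuclideanSpace.equiv (Fin 2) ℝ).toHomeomorph.isCompact_preimage.2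
    (isCompact_Icc (a := ![x₀, y₀]) (b := ![x₁, y₁]))
  ext p
  simp only [rect, Set.mem_ofPred_eq, Set.mem_Icc, Set.mem_preimage, Pi.le_def, Fin.forall_fin_two]
  exact and_and_and_comm

/-- The affine parametrization of `[x₀, x₁] × [y₀, y₁]` by the unit square. -/
noncomputable def rectMap (x₀ x₁ y₀ y₁ : ℝ) (z : I × I) : Plane :=
  !₂[AffineMap.lineMap x₀ x₁ (z.1 : ℝ), AffineMap.lineMap y₀ y₁ (z.2 : ℝ)]

@[fun_prop]
lemma continuous_rectMap (x₀ x₁ y₀ y₁ : ℝ) : Continuous (rectMap x₀ x₁ y₀ y₁) := by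
  refine (PiLp.continuous_toLp 2 _).comp (continuous_pi fun i => ?_)
  fin_cases i
  · exact AffineMap.lineMap_continuous.comp (by fun_prop)
  · exact AffineMap.lineMap_continuous.comp (by fun_prop)

lemma rectMap_mem_rect {x₀ x₁ y₀ y₁ : ℝ} (hx : x₀ ≤ x₁) (hy : y₀ ≤ y₁) (z : I × I) :
    rectMap x₀ x₁ y₀ y₁ z ∈ rect x₀ x₁ y₀ y₁ :=
  ⟨(convex_Icc x₀ x₁).lineMap_mem ⟨le_rfl, hx⟩ ⟨hx, le_rfl⟩ z.1.2,
    (convex_Icc y₀ y₁).lineMap_mem ⟨le_rfl, hy⟩ ⟨hy, le_rfl⟩ z.2.2⟩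

lemma exists_verticalCrossing_avoiding {x₀ x₁ y₀ y₁ : ℝ} (hx : x₀ ≤ x₁) (hy : y₀ ≤ y₁)
    {K₁ K₂ : Set Plane} (h₁ : IsClosed K₁) (h₂ : IsClosed K₂)
    (hdis : Disjoint (K₁ ∩ rect x₀ x₁ y₀ y₁) K₂)
    (hright : ∀ p ∈ rect x₀ x₁ y₀ y₁, p 0 = x₁ → p ∉ K₁)
    (hleft : ∀ p ∈ rect x₀ x₁ y₀ y₁, p 0 = x₀ → p ∉ K₂) :
    ∃ γ, IsVerticalCrossing x₀ x₁ y₀ y₁ γ ∧ ∀ t, γ t ∉ K₁ ∪ K₂ := by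
  set ρ := rectMap x₀ x₁ y₀ y₁
  have hρ : Continuous ρ := continuous_rectMap x₀ x₁ y₀ y₁
  have hmem : ∀ z, ρ z ∈ rect x₀ x₁ y₀ y₁ := rectMap_mem_rect hx hy
  obtain ⟨s, s', hj⟩ := exists_joinedIn_of_square (h₁.preimage hρ) (h₂.preimage hρ)
    (Set.disjoint_left.2 fun z hz => Set.disjoint_left.1 hdis ⟨hz, hmem z⟩)
    (fun t => hright _ (hmem _) (AffineMap.lineMap_apply_one _ _))
    (fun t => hleft _ (hmem _) (AffineMap.lineMap_apply_zero _ _))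
  refine ⟨ContinuousMap.comp ⟨ρ, hρ⟩ hj.somePath, ⟨fun t => hmem _, ?_, ?_⟩, hj.somePath_mem⟩
  · simp [ρ, rectMap]
  · simp [ρ, rectMap]

end Topology

/-! ### Voronoi cells -/

section Cells

open Topology
open scoped RealInnerProductSpace

lemma norm_sub_sq_sub_norm_sub_sq {E : Type*} [NormedAddCommGroup E] [InnerProductSpace ℝ E]
    (u v x : E) :
    ‖v - x‖ ^ 2 - ‖u - x‖ ^ 2 = ‖v‖ ^ 2 - ‖u‖ ^ 2 - 2 * ⟪v - u, x⟫ := by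
  rw [norm_sub_sq_real, norm_sub_sq_real, inner_sub_left]
  ring

lemma convex_setOf_norm_sub_le {E : Type*} [NormedAddCommGroup E] [InnerProductSpace ℝ E]
    (u v : E) : Convex ℝ {x | ‖u - x‖ ≤ ‖v - x‖} := by
  convert! convex_halfSpace_le (innerₛₗ ℝ (v - u)).isLinear ((‖v‖ ^ 2 - ‖u‖ ^ 2) / 2) using 1
  ext x
  rw [Set.mem_ofPred_eq, Set.mem_ofPred_eq, ← sq_le_sq₀ (norm_nonneg _) (norm_nonneg _),
    ← sub_nonneg, norm_sub_sq_sub_norm_sub_sq, innerₛₗ_apply_apply]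
  constructor <;> intro h <;> linarith

lemma convex_setOf_norm_sub_lt {E : Type*} [NormedAddCommGroup E] [InnerProductSpace ℝ E]
    (u v : E) : Convex ℝ {x | ‖u - x‖ < ‖v - x‖} := by
  convert! convex_halfSpace_lt (innerₛₗ ℝ (v - u)).isLinear ((‖v‖ ^ 2 - ‖u‖ ^ 2) / 2) using 1
  ext x
  rw [Set.mem_ofPred_eq, Set.mem_ofPred_eq, ← sq_lt_sq₀ (norm_nonneg _) (norm_nonneg _),
    ← sub_pos, norm_sub_sq_sub_norm_sub_sq, innerₛₗ_apply_apply]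
  constructor <;> intro h <;> linarith

variable {η : Set Plane} {u v x y z : Plane}

lemma cell_eq_biInter (η : Set Plane) (u : Plane) :
    cell η u = ⋂ v ∈ η, {x | ‖u - x‖ ≤ ‖v - x‖} := by
  ext x
  simp [cell]

lemma isClosed_cell (η : Set Plane) (u : Plane) : IsClosed (cell η u) := by
  rw [cell_eq_biInter]
  exact isClosed_biInter fun v _ => isClosed_le (by fun_prop) (by fun_prop)

lemma convex_cell (η : Set Plane) (u : Plane) : Convex ℝ (cell η u) := by
  rw [cell_eq_biInter]
  exact convex_iInter₂ fun v _ => convex_setOf_norm_sub_le u v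

lemma mem_cell_of_norm_sub_le (hu : x ∈ cell η u) (h : ‖v - x‖ ≤ ‖u - x‖) : x ∈ cell η v :=
  fun w hw => h.trans (hu w hw)

lemma mem_cell_of_mem_segment (hu : u ∈ η) (hx : x ∈ cell η u) (hy : y ∈ cell η u)
    (hz : z ∈ segment ℝ x y) (hzv : z ∈ cell η v) : x ∈ cell η v ∨ y ∈ cell η v := by
  by_contra! h
  exact ((convex_setOf_norm_sub_lt u v).segment_subset
    (not_le.1 fun hle => h.1 (mem_cell_of_norm_sub_le hx hle))
    (not_le.1 fun hle => h.2 (mem_cell_of_norm_sub_le hy hle)) hz).not_ge (hzv u hu)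

/-- The points of `η` whose cells contain `x`, i.e. the points of `η` nearest to `x`. -/
def nuclei (η : Set Plane) (x : Plane) : Set Plane := {u ∈ η | x ∈ cell η u}

lemma norm_sub_eq_of_mem_nuclei (hu : u ∈ nuclei η x) (hv : v ∈ nuclei η x) :
    ‖u - x‖ = ‖v - x‖ :=
  (hu.2 v hv.1).antisymm (hv.2 u hu.1)

lemma exists_nuclei_subset_sphere (η : Set Plane) (x : Plane) :
    ∃ r, nuclei η x ⊆ η ∩ Metric.sphere x r := by
  obtain h | ⟨u, hu⟩ := (nuclei η x).eq_empty_or_nonempty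
  · exact ⟨0, h ▸ Set.empty_subset _⟩
  · refine ⟨‖u - x‖, fun v hv => ⟨hv.1, ?_⟩⟩
    rw [mem_sphere_iff_norm, norm_sub_eq_of_mem_nuclei hv hu]

/-- A nonempty locally finite set of points, so that every point of the plane has a nearest
point in `η`. -/
structure LocFinite (η : Set Plane) : Prop where
  nonempty : η.Nonempty
  finite_inter : ∀ B : Set Plane, Bornology.IsBounded B → (η ∩ B).Finite

lemma LocFinite.nuclei_nonempty (h : LocFinite η) (x : Plane) : (nuclei η x).Nonempty := by
  obtain ⟨v, hv⟩ := h.nonempty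
  obtain ⟨u, hu, hmin⟩ := Set.exists_min_image _ (fun u => ‖u - x‖)
    (h.finite_inter _ (Metric.isBounded_closedBall (x := x) (r := ‖v - x‖)))
    ⟨v, hv, mem_closedBall_iff_norm.2 le_rfl⟩
  refine ⟨u, hu.1, fun w hw => ?_⟩
  by_cases hwv : ‖w - x‖ ≤ ‖v - x‖
  · exact hmin w ⟨hw, mem_closedBall_iff_norm.2 hwv⟩
  · exact (mem_closedBall_iff_norm.1 hu.2).trans (not_le.1 hwv).le

lemma LocFinite.finite_setOf_cell_inter (h : LocFinite η) {B : Set Plane}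
    (hB : Bornology.IsBounded B) : {u ∈ η | (cell η u ∩ B).Nonempty}.Finite := by
  obtain ⟨v, hv⟩ := h.nonempty
  obtain ⟨r, hr⟩ := hB.subset_closedBall v
  refine (h.finite_inter _ (Metric.isBounded_closedBall (x := v) (r := r + r))).subset ?_
  rintro u ⟨hu, x, hx, hxB⟩
  have hvx : ‖v - x‖ ≤ r := by
    rw [norm_sub_rev]
    exact mem_closedBall_iff_norm.1 (hr hxB)
  refine ⟨hu, mem_closedBall_iff_norm.2 ?_⟩
  calc ‖u - v‖ ≤ ‖u - x‖ + ‖v - x‖ := by simpa using norm_sub_le (u - x) (v - x)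
    _ ≤ r + r := add_le_add ((hx v hv).trans hvx) hvx

lemma LocFinite.eventually_nuclei_subset (h : LocFinite η) (x : Plane) :
    ∀ᶠ y in 𝓝 x, nuclei η y ⊆ nuclei η x := by
  have hfin := h.finite_setOf_cell_inter (Metric.isBounded_ball (x := x) (r := 1))
  have hclosed : IsClosed
      (⋃ u ∈ {u ∈ η | (cell η u ∩ Metric.ball x 1).Nonempty ∧ x ∉ cell η u}, cell η u) :=
    (hfin.subset fun u hu => ⟨hu.1, hu.2.1⟩).isClosed_biUnion fun u _ => isClosed_cell η u
  filter_upwards [hclosed.isOpen_compl.mem_nhds (by simp), Metric.ball_mem_nhds x one_pos]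
    with y hy hyball u hu
  by_contra hux
  exact hy (Set.mem_biUnion (⟨hu.1, ⟨y, hu.2, hyball⟩, fun hx => hux ⟨hu.1, hx⟩⟩ :
    u ∈ {u ∈ η | (cell η u ∩ Metric.ball x 1).Nonempty ∧ x ∉ cell η u}) hu.2)

lemma norm_sub_add_smul_le_iff {E : Type*} [NormedAddCommGroup E] [InnerProductSpace ℝ E]
    {u v p : E} (n : E) (h : ‖u - p‖ = ‖v - p‖) {t : ℝ} (ht : 0 < t) :
    ‖u - (p + t • n)‖ ≤ ‖v - (p + t • n)‖ ↔ ⟪v, n⟫ ≤ ⟪u, n⟫ := by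
  have hsq := norm_sub_sq_sub_norm_sub_sq u v p
  have hmove := norm_sub_sq_sub_norm_sub_sq u v (p + t • n)
  rw [h, sub_self] at hsq
  rw [inner_add_right, inner_smul_right, inner_sub_left v u n] at hmove
  rw [← sq_le_sq₀ (norm_nonneg _) (norm_nonneg _), ← sub_nonneg,
    show ‖v - (p + t • n)‖ ^ 2 - ‖u - (p + t • n)‖ ^ 2 = 2 * t * (⟪u, n⟫ - ⟪v, n⟫) by linarith,
    mul_nonneg_iff_of_pos_left (by positivity), sub_nonneg]

lemma LocFinite.exists_nuclei_eq (h : LocFinite η) (p n : Plane) {F : Set Plane} (hF : F ∈ 𝓝 p) :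
    ∃ t : ℝ, p + t • n ∈ F ∧
      nuclei η (p + t • n) = {u ∈ nuclei η p | ∀ v ∈ nuclei η p, ⟪v, n⟫ ≤ ⟪u, n⟫} := by
  have hcont : Continuous fun t : ℝ => p + t • n := by fun_prop
  have htendsto : Filter.Tendsto (fun t : ℝ => p + t • n) (𝓝[>] 0) (𝓝 p) := by
    simpa using (hcont.tendsto 0).mono_left nhdsWithin_le_nhds
  obtain ⟨t, ⟨htF, hsub⟩, ht⟩ := (((htendsto.eventually hF).and
    (htendsto.eventually (h.eventually_nuclei_subset p))).and self_mem_nhdsWithin).exists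
  have hle {u v : Plane} (hu : u ∈ nuclei η p) (hv : v ∈ nuclei η p) :
      ‖u - (p + t • n)‖ ≤ ‖v - (p + t • n)‖ ↔ ⟪v, n⟫ ≤ ⟪u, n⟫ :=
    norm_sub_add_smul_le_iff n (norm_sub_eq_of_mem_nuclei hu hv) ht
  refine ⟨t, htF, Set.Subset.antisymm ?_ ?_⟩
  · exact fun u hu => ⟨hsub hu, fun v hv => (hle (hsub hu) hv).1 (hu.2 v hv.1)⟩
  · rintro u ⟨hu, hmax⟩
    obtain ⟨v, hv⟩ := h.nuclei_nonempty (p + t • n)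
    exact ⟨hu.1, mem_cell_of_norm_sub_le hv.2 ((hle hu (hsub hv)).2 (hmax v (hsub hv)))⟩

lemma exists_inner_eq_and_inner_lt {E : Type*} [NormedAddCommGroup E] [InnerProductSpace ℝ E]
    {u v w : E} (h : ¬ Collinear ℝ {u, v, w}) : ∃ n : E, ⟪v, n⟫ = ⟪u, n⟫ ∧ ⟪w, n⟫ < ⟪u, n⟫ := by
  obtain ⟨y, hy, n, hn, hyn⟩ := (ℝ ∙ (v - u)).exists_add_mem_mem_orthogonal (u - w)
  have hvu : ⟪v - u, n⟫ = 0 := hn _ (Submodule.mem_span_singleton_self _)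
  have huw : ⟪u - w, n⟫ = ‖n‖ ^ 2 := by
    rw [hyn, inner_add_left, hn y hy, zero_add, real_inner_self_eq_norm_sq]
  have hn0 : n ≠ 0 := by
    rintro rfl
    obtain ⟨t, rfl⟩ := Submodule.mem_span_singleton.1 hy
    refine h ((collinear_iff_of_mem (p₀ := u) (by simp)).2 ⟨v - u, ?_⟩)
    rintro x (rfl | rfl | rfl)
    · exact ⟨0, by simp⟩
    · exact ⟨1, by simp⟩
    · refine ⟨-t, ?_⟩
      rw [add_zero] at hyn
      rw [neg_smul, ← hyn]
      simp
  rw [inner_sub_left] at hvu huw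
  exact ⟨n, sub_eq_zero.1 hvu, by nlinarith [norm_pos_iff.2 hn0]⟩

variable {x₀ x₁ y₀ y₁ : ℝ}

/-- General position of `η` with respect to `[x₀, x₁] × [y₀, y₁]`: cells touch along the sides and
at the corners of the rectangle in as few ways as possible, and two cells that meet on a vertical
side do not meet along it. -/
structure GeneralPosition (η : Set Plane) (x₀ x₁ y₀ y₁ : ℝ) : Prop extends LocFinite η where
  encard_nuclei_le_three : ∀ p, (nuclei η p).encard ≤ 3
  encard_nuclei_le_two : ∀ p, (p 0 = x₀ ∨ p 0 = x₁) ∨ (p 1 = y₀ ∨ p 1 = y₁) →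
    (nuclei η p).encard ≤ 2
  encard_nuclei_le_one : ∀ p, p 0 = x₀ ∨ p 0 = x₁ → p 1 = y₀ ∨ p 1 = y₁ →
    (nuclei η p).encard ≤ 1
  injOn_snd : Set.InjOn (fun u : Plane => u 1) η

lemma Icc_mem_nhds_of_ne {α : Type*} [LinearOrder α] [TopologicalSpace α] [OrderTopology α]
    {a b c : α} (h : c ∈ Set.Icc a b) (hne : ¬ (c = a ∨ c = b)) : Set.Icc a b ∈ 𝓝 c :=
  Icc_mem_nhds (h.1.lt_of_ne fun e => hne (Or.inl e.symm)) (h.2.lt_of_ne fun e => hne (Or.inr e))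

lemma not_collinear_of_mem_nuclei {w p : Plane} (hu : u ∈ nuclei η p) (hv : v ∈ nuclei η p)
    (hw : w ∈ nuclei η p) (huv : u ≠ v) (huw : u ≠ w) (hvw : v ≠ w) :
    ¬ Collinear ℝ {u, v, w} := by
  obtain ⟨r, hr⟩ := exists_nuclei_subset_sphere η p
  have hcosph : EuclideanGeometry.Cospherical {u, v, w} := ⟨p, r, by
    rintro x (rfl | rfl | rfl)
    exacts [(hr hu).2, (hr hv).2, (hr hw).2]⟩
  exact affineIndependent_iff_not_collinear_set.1 (hcosph.affineIndependent_of_ne huv huw hvw)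

lemma GeneralPosition.rect_mem_nhds_of_three_le (h : GeneralPosition η x₀ x₁ y₀ y₁) {p : Plane}
    (hp : p ∈ rect x₀ x₁ y₀ y₁) (hcard : 3 ≤ (nuclei η p).encard) : rect x₀ x₁ y₀ y₁ ∈ 𝓝 p := by
  have hside : ¬ ((p 0 = x₀ ∨ p 0 = x₁) ∨ (p 1 = y₀ ∨ p 1 = y₁)) := fun hs =>
    absurd (hcard.trans (h.encard_nuclei_le_two p hs)) (by decide)
  rw [not_or] at hside
  exact Filter.inter_mem
    ((by fun_prop : Continuous fun q : Plane => q 0).continuousAt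
      (Icc_mem_nhds_of_ne hp.1 hside.1))
    ((by fun_prop : Continuous fun q : Plane => q 1).continuousAt
      (Icc_mem_nhds_of_ne hp.2 hside.2))

lemma GeneralPosition.exists_nuclei_eq_pair (h : GeneralPosition η x₀ x₁ y₀ y₁) {p : Plane}
    (hp : p ∈ rect x₀ x₁ y₀ y₁) (huv : u ≠ v) (hu : u ∈ nuclei η p) (hv : v ∈ nuclei η p) :
    ∃ z ∈ rect x₀ x₁ y₀ y₁, nuclei η z = {u, v} := by
  by_cases hex : ∃ w ∈ nuclei η p, w ∉ ({u, v} : Set Plane)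
  swap
  · push Not at hex
    exact ⟨p, hp, Set.Subset.antisymm hex (Set.pair_subset hu hv)⟩
  obtain ⟨w, hw, hwuv⟩ := hex
  have hwu : w ≠ u := fun e => hwuv (Or.inl e)
  have hwv : w ≠ v := fun e => hwuv (Or.inr e)
  have hcard : ({u, v, w} : Set Plane).encard = 3 :=
    Set.encard_eq_three.2 ⟨u, v, w, huv, hwu.symm, hwv.symm, rfl⟩
  have hsub : {u, v, w} ⊆ nuclei η p := by
    rintro x (rfl | rfl | rfl) <;> assumption
  have hnuclei : nuclei η p = {u, v, w} :=
    (Set.Finite.eq_of_subset_of_encard_le (by simp) hsub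
      ((h.encard_nuclei_le_three p).trans hcard.ge)).symm
  have hrect : rect x₀ x₁ y₀ y₁ ∈ 𝓝 p :=
    h.rect_mem_nhds_of_three_le hp (hcard.ge.trans (Set.encard_le_encard hsub))
  obtain ⟨n, hvn, hwn⟩ := exists_inner_eq_and_inner_lt
    (not_collinear_of_mem_nuclei hu hv hw huv hwu.symm hwv.symm)
  obtain ⟨t, hz, hnz⟩ := h.exists_nuclei_eq p n hrect
  refine ⟨_, hz, ?_⟩
  rw [hnz, hnuclei]
  ext x
  simp only [Set.mem_ofPred_eq, Set.mem_insert_iff, Set.mem_singleton_iff, forall_eq_or_imp,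
    forall_eq]
  constructor
  · rintro ⟨rfl | rfl | rfl, hmax⟩
    · exact Or.inl rfl
    · exact Or.inr rfl
    · exact absurd hmax.1 hwn.not_ge
  · rintro (rfl | rfl)
    · exact ⟨Or.inl rfl, le_rfl, hvn.le, hwn.le⟩
    · exact ⟨Or.inr (Or.inl rfl), hvn.ge, le_rfl, hwn.le.trans hvn.ge⟩

lemma GeneralPosition.exists_nuclei_eq_singleton (h : GeneralPosition η x₀ x₁ y₀ y₁) {p : Plane}
    (hp : p ∈ rect x₀ x₁ y₀ y₁) (hp0 : p 0 = x₀ ∨ p 0 = x₁) (hu : u ∈ nuclei η p) :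
    ∃ z ∈ rect x₀ x₁ y₀ y₁, z 0 = p 0 ∧ nuclei η z = {u} := by
  by_cases hex : ∃ w ∈ nuclei η p, w ≠ u
  swap
  · push Not at hex
    exact ⟨p, hp, rfl, Set.Subset.antisymm hex (Set.singleton_subset_iff.2 hu)⟩
  obtain ⟨w, hw, hwu⟩ := hex
  have hcard : ({u, w} : Set Plane).encard = 2 := Set.encard_pair hwu.symm
  have hsub : {u, w} ⊆ nuclei η p := Set.pair_subset hu hw
  have hnuclei : nuclei η p = {u, w} :=
    (Set.Finite.eq_of_subset_of_encard_le (by simp) hsub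
      ((h.encard_nuclei_le_two p (Or.inl hp0)).trans hcard.ge)).symm
  have hcorner : ¬ (p 1 = y₀ ∨ p 1 = y₁) := fun hs => by
    have := (Set.encard_le_encard hsub).trans (h.encard_nuclei_le_one p hp0 hs)
    rw [hcard] at this
    exact absurd this (by decide)
  have hside : {q : Plane | q 1 ∈ Set.Icc y₀ y₁} ∈ 𝓝 p :=
    (by fun_prop : Continuous fun q : Plane => q 1).continuousAt (Icc_mem_nhds_of_ne hp.2 hcorner)
  set n : Plane := !₂[0, u 1 - w 1]
  have hinner (x : Plane) : ⟪x, n⟫ = (u 1 - w 1) * x 1 := by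
    simp [n, PiLp.inner_apply, Fin.sum_univ_two]
  have hlt : ⟪w, n⟫ < ⟪u, n⟫ := by
    have hne : u 1 - w 1 ≠ 0 := sub_ne_zero.2 fun e => hwu (h.injOn_snd hw.1 hu.1 e.symm)
    rw [hinner, hinner, ← sub_pos, ← mul_sub]
    exact mul_self_pos.2 hne
  obtain ⟨t, hz, hnz⟩ := h.exists_nuclei_eq p n hside
  have hz0 : (p + t • n) 0 = p 0 := by simp [n]
  refine ⟨p + t • n, ⟨by rw [hz0]; exact hp.1, hz⟩, hz0, ?_⟩
  rw [hnz, hnuclei]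
  ext x
  simp only [Set.mem_ofPred_eq, Set.mem_insert_iff, Set.mem_singleton_iff, forall_eq_or_imp,
    forall_eq]
  constructor
  · rintro ⟨rfl | rfl, hmax⟩
    · rfl
    · exact absurd hmax.1 hlt.not_ge
  · rintro rfl
    exact ⟨Or.inl rfl, le_rfl, hlt.le⟩

end Cells

section CellSystem

lemma connected_of_iUnion_eq_univ {X V : Type*} [TopologicalSpace X] [ConnectedSpace X] [Finite V]
    {G : SimpleGraph V} {F : V → Set X} (hclosed : ∀ v, IsClosed (F v))
    (hne : ∀ v, (F v).Nonempty) (hcover : ⋃ v, F v = Set.univ)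
    (hadj : ∀ v w, v ≠ w → (F v ∩ F w).Nonempty → G.Adj v w) : G.Connected := by
  obtain ⟨x⟩ := (inferInstance : Nonempty X)
  obtain ⟨v₀, -⟩ := Set.mem_iUnion.1 (hcover ▸ Set.mem_univ x)
  have hclosed_union (D : Set V) : IsClosed (⋃ v ∈ D, F v) :=
    (Set.toFinite D).isClosed_biUnion fun v _ => hclosed v
  refine { preconnected := fun v w => ?_, nonempty := ⟨v₀⟩ }
  by_contra hvw
  obtain ⟨y, -, hy, hy'⟩ := isPreconnected_closed_iff.1 isPreconnected_univ _ _
    (hclosed_union {a | G.Reachable v a}) (hclosed_union {a | ¬ G.Reachable v a})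
    (fun y _ => by
      obtain ⟨a, ha⟩ := Set.mem_iUnion.1 (hcover ▸ Set.mem_univ y)
      exact (em (G.Reachable v a)).imp (Set.mem_biUnion · ha) (Set.mem_biUnion · ha))
    ((hne v).imp fun y hy => ⟨trivial, Set.mem_biUnion (SimpleGraph.Reachable.refl v) hy⟩)
    ((hne w).imp fun y hy => ⟨trivial, Set.mem_biUnion hvw hy⟩)
  obtain ⟨a, ha, hya⟩ := Set.mem_iUnion₂.1 hy
  obtain ⟨b, hb, hyb⟩ := Set.mem_iUnion₂.1 hy'
  exact hb (ha.trans (hadj a b (fun e => hb (e ▸ ha)) ⟨y, hya, hyb⟩).reachable)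

lemma ChainTo.exists_joinedIn {X V : Type*} [TopologicalSpace X] {G : SimpleGraph V}
    {right T : Set V} {v : V} (h : ChainTo G right T v) {D : V → Set X} {R Z : Set X}
    (hjoin : ∀ v ∈ T, ∀ x ∈ D v, ∀ y ∈ D v, JoinedIn Z x y)
    (hadj : ∀ v ∈ T, ∀ w ∈ T, G.Adj v w → (D v ∩ D w).Nonempty)
    (hright : ∀ v ∈ T, v ∈ right → (D v ∩ R).Nonempty) :
    ∀ x ∈ D v, ∃ y ∈ R, JoinedIn Z x y := by
  induction h with
  | base hT hr =>
    intro x hx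
    obtain ⟨y, hy, hyR⟩ := hright _ hT hr
    exact ⟨y, hyR, hjoin _ hT x hx y hy⟩
  | step hT hvw hw ih =>
    intro x hx
    obtain ⟨z, hzv, hzw⟩ := hadj _ hT _ hw.mem hvw
    obtain ⟨y, hyR, hzy⟩ := ih z hzw
    exact ⟨y, hyR, (hjoin _ hT x hx z hzv).trans hzy⟩

variable {η : Set Plane} {x₀ x₁ y₀ y₁ : ℝ} {γ : C(unitInterval, Plane)}

/-- The points of `η` whose cells meet `[x₀, x₁] × [y₀, y₁]`. -/
def cellsIn (η : Set Plane) (x₀ x₁ y₀ y₁ : ℝ) : Set η :=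
  {u | (cell η u ∩ rect x₀ x₁ y₀ y₁).Nonempty}

lemma LocFinite.finite_cellsIn (h : LocFinite η) : (cellsIn η x₀ x₁ y₀ y₁).Finite :=
  ((h.finite_setOf_cell_inter (isCompact_rect x₀ x₁ y₀ y₁).isBounded).preimage
    Subtype.val_injective.injOn).subset fun u hu => ⟨u.2, hu⟩

/-- Two cells are adjacent if they have a common point in `[x₀, x₁] × [y₀, y₁]`. -/
def cellGraph (η : Set Plane) (x₀ x₁ y₀ y₁ : ℝ) : SimpleGraph (cellsIn η x₀ x₁ y₀ y₁) where
  Adj u v := u ≠ v ∧ (cell η u ∩ cell η v ∩ rect x₀ x₁ y₀ y₁).Nonempty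
  symm := ⟨fun u v h => ⟨h.1.symm, Set.inter_comm (cell η u) (cell η v) ▸ h.2⟩⟩
  loopless := ⟨fun _ h => h.1 rfl⟩

/-- The cells that meet `[x₀, x₁] × [y₀, y₁]` on the vertical line through `(a, 0)`. -/
def cellsOnLine (η : Set Plane) (x₀ x₁ y₀ y₁ a : ℝ) : Set (cellsIn η x₀ x₁ y₀ y₁) :=
  {u | ∃ p ∈ rect x₀ x₁ y₀ y₁, p 0 = a ∧ p ∈ cell η u}

/-- The cells that meet `[x₀, x₁] × [y₀, y₁]` and the path `γ`. -/
def cellsOf (η : Set Plane) (x₀ x₁ y₀ y₁ : ℝ) (γ : C(unitInterval, Plane)) :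
    Set (cellsIn η x₀ x₁ y₀ y₁) :=
  {u | Meets η γ u}

lemma mem_cellsIn_of_meets {u : η} (hγ : ∀ t, γ t ∈ rect x₀ x₁ y₀ y₁) (h : Meets η γ u) :
    u ∈ cellsIn η x₀ x₁ y₀ y₁ :=
  h.elim fun t ht => ⟨γ t, ht, hγ t⟩

lemma LocFinite.connected_induce_cellsOf (h : LocFinite η)
    (hγ : ∀ t, γ t ∈ rect x₀ x₁ y₀ y₁) :
    ((cellGraph η x₀ x₁ y₀ y₁).induce (cellsOf η x₀ x₁ y₀ y₁ γ)).Connected := by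
  have := (h.finite_cellsIn (x₀ := x₀) (x₁ := x₁) (y₀ := y₀) (y₁ := y₁)).to_subtype
  refine connected_of_iUnion_eq_univ (F := fun u => γ ⁻¹' cell η u)
    (fun u => (isClosed_cell η _).preimage γ.continuous) (fun u => u.2)
    (Set.eq_univ_of_forall fun t => ?_)
    fun u v huv ⟨t, hu, hv⟩ => ⟨Subtype.coe_injective.ne huv, γ t, ⟨hu, hv⟩, hγ t⟩
  obtain ⟨u, hu⟩ := h.nuclei_nonempty (γ t)
  exact Set.mem_iUnion.2 ⟨⟨⟨⟨u, hu.1⟩, γ t, hu.2, hγ t⟩, t, hu.2⟩, hu.2⟩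

lemma separates_cellsOf (hγ : IsVerticalCrossing x₀ x₁ y₀ y₁ γ) :
    Separates (cellGraph η x₀ x₁ y₀ y₁) (cellsOnLine η x₀ x₁ y₀ y₁ x₀)
      (cellsOnLine η x₀ x₁ y₀ y₁ x₁) (cellsOf η x₀ x₁ y₀ y₁ γ) := by
  rintro v ⟨x, hxr, hx0, hxv⟩ hchain
  obtain ⟨y, hy1, hxy⟩ := hchain.exists_joinedIn
    (D := fun v : cellsIn η x₀ x₁ y₀ y₁ => cell η v ∩ rect x₀ x₁ y₀ y₁) (R := {y | y 0 = x₁})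
    (Z := {x ∈ rect x₀ x₁ y₀ y₁ | ∃ v ∉ cellsOf η x₀ x₁ y₀ y₁ γ, x ∈ cell η v})
    (fun v hv x hx y hy => JoinedIn.of_segment_subset fun z hz =>
      ⟨(convex_rect _ _ _ _).segment_subset hx.2 hy.2 hz, v, hv,
        (convex_cell _ _).segment_subset hx.1 hy.1 hz⟩)
    (fun v _ w _ ⟨_, p, ⟨hpv, hpw⟩, hp⟩ => ⟨p, ⟨hpv, hp⟩, hpw, hp⟩)
    (fun v _ ⟨p, hp, hp1, hpv⟩ => ⟨p, ⟨hpv, hp⟩, hp1⟩) x ⟨hxv, hxr⟩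
  obtain ⟨s, t, hst⟩ := exists_eq_of_crossings (γ := hxy.somePath.toContinuousMap)
    ⟨fun t => (hxy.somePath_mem t).1, by simpa using hx0, by simpa using hy1⟩ hγ
  obtain ⟨w, hw, hsw⟩ := (hxy.somePath_mem s).2
  exact hw ⟨t, hst ▸ hsw⟩

lemma LocFinite.exists_crossing_of_separates (h : LocFinite η) (hx : x₀ ≤ x₁) (hy : y₀ ≤ y₁)
    {S : Set (cellsIn η x₀ x₁ y₀ y₁)}
    (hS : Separates (cellGraph η x₀ x₁ y₀ y₁) (cellsOnLine η x₀ x₁ y₀ y₁ x₀)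
      (cellsOnLine η x₀ x₁ y₀ y₁ x₁) S) :
    ∃ γ, IsVerticalCrossing x₀ x₁ y₀ y₁ γ ∧ cellsOf η x₀ x₁ y₀ y₁ γ ⊆ S := by
  have := (h.finite_cellsIn (x₀ := x₀) (x₁ := x₁) (y₀ := y₀) (y₁ := y₁)).to_subtype
  have hclosed (D : Set (cellsIn η x₀ x₁ y₀ y₁)) : IsClosed (⋃ u ∈ D, cell η u) :=
    (Set.toFinite D).isClosed_biUnion fun u _ => isClosed_cell η _
  set N := {v | ChainTo (cellGraph η x₀ x₁ y₀ y₁) (cellsOnLine η x₀ x₁ y₀ y₁ x₁) Sᶜ v}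
  obtain ⟨γ, hγ, havoid⟩ := exists_verticalCrossing_avoiding hx hy (hclosed (Sᶜ \ N)) (hclosed N)
    (Set.disjoint_left.2 fun p ⟨hpM, hp⟩ hpN => by
      obtain ⟨v, ⟨hvS, hvN⟩, hpv⟩ := Set.mem_iUnion₂.1 hpM
      obtain ⟨w, hwN, hpw⟩ := Set.mem_iUnion₂.1 hpN
      exact hvN (ChainTo.step hvS ⟨fun e => hvN (e ▸ hwN), p, ⟨hpv, hpw⟩, hp⟩ hwN))
    (fun p hp hp1 hpM => by
      obtain ⟨v, ⟨hvS, hvN⟩, hpv⟩ := Set.mem_iUnion₂.1 hpM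
      exact hvN (ChainTo.base hvS ⟨p, hp, hp1, hpv⟩))
    (fun p hp hp0 hpN => by
      obtain ⟨v, hvN, hpv⟩ := Set.mem_iUnion₂.1 hpN
      exact hS v ⟨p, hp, hp0, hpv⟩ hvN)
  refine ⟨γ, hγ, fun v ⟨t, ht⟩ => ?_⟩
  by_contra hvS
  exact havoid t ((em (v ∈ N)).elim (fun hv => Or.inr (Set.mem_biUnion hv ht))
    fun hv => Or.inl (Set.mem_biUnion (⟨hvS, hv⟩ : v ∈ Sᶜ \ N) ht))

/-- The vertical crossings of `[x₀, x₁] × [y₀, y₁]` by paths, each seen as the set of cells that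
it meets. -/
def LocFinite.crossingSystem (h : LocFinite η) (hx : x₀ ≤ x₁) (hy : y₀ ≤ y₁) :
    CrossingSystem (cellsIn η x₀ x₁ y₀ y₁) where
  graph := cellGraph η x₀ x₁ y₀ y₁
  left := cellsOnLine η x₀ x₁ y₀ y₁ x₀
  right := cellsOnLine η x₀ x₁ y₀ y₁ x₁
  IsCrossing δ := ∃ γ, IsVerticalCrossing x₀ x₁ y₀ y₁ γ ∧ cellsOf η x₀ x₁ y₀ y₁ γ = δ
  connected := by
    rintro _ ⟨γ, hγ, rfl⟩
    exact h.connected_induce_cellsOf hγ.1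
  separates_iff := by
    refine ⟨fun hS => ?_, ?_⟩
    · obtain ⟨γ, hγ, hγS⟩ := h.exists_crossing_of_separates hx hy hS
      exact ⟨_, ⟨γ, hγ, rfl⟩, hγS⟩
    · rintro ⟨_, ⟨γ, hγ, rfl⟩, hγS⟩ v hv hchain
      exact separates_cellsOf hγ v hv (hchain.mono (Set.compl_subset_compl.2 hγS))

lemma LocFinite.crossingCounts_eq (h : LocFinite η) (hx : x₀ ≤ x₁) (hy : y₀ ≤ y₁)
    (ω : Colouring η) :
    crossingCounts η ω x₀ x₁ y₀ y₁ = (h.crossingSystem hx hy).counts Set.univ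
      ((cellsIn η x₀ x₁ y₀ y₁).domRestrict ω) := by
  ext m
  constructor
  · rintro ⟨γ, hγ, hdisj⟩
    refine ⟨fun i => cellsOf η x₀ x₁ y₀ y₁ (γ i), fun i => ?_, fun i j hij =>
      Set.disjoint_left.2 fun v hi hj => hdisj i j hij v ⟨hi, hj⟩⟩
    obtain ⟨c, hc⟩ := (hγ i).2
    exact ⟨c, ⟨γ i, (hγ i).1, rfl⟩, Set.subset_univ _, fun v hv => hc v hv⟩
  · rintro ⟨δ, hδ, hdisj⟩
    choose c hc using hδ
    choose γ hγ hγδ using fun i => (hc i).isCrossing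
    have hmem {i u} (hu : Meets η (γ i) u) :
        (⟨u, mem_cellsIn_of_meets (hγ i).1 hu⟩ : cellsIn η x₀ x₁ y₀ y₁) ∈ δ i :=
      hγδ i ▸ hu
    exact ⟨γ, fun i => ⟨hγ i, c i, fun u hu => (hc i).colour_eq _ (hmem hu)⟩,
      fun i j hij u hu => Set.disjoint_left.1 (hdisj hij) (hmem hu.1) (hmem hu.2)⟩

/-- The points of `[x₀, x₁] × [y₀, y₁]` that lie in red cells only. -/
def redRegion (η : Set Plane) (ω : Colouring η) (x₀ x₁ y₀ y₁ : ℝ) : Set Plane :=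
  {x ∈ rect x₀ x₁ y₀ y₁ | ∀ u : η, x ∈ cell η u → ω u = true}

lemma segment_subset_redRegion {ω : Colouring η} {u : η} {x y : Plane} (hx : x ∈ cell η u)
    (hy : y ∈ cell η u) (hxZ : x ∈ redRegion η ω x₀ x₁ y₀ y₁)
    (hyZ : y ∈ redRegion η ω x₀ x₁ y₀ y₁) : segment ℝ x y ⊆ redRegion η ω x₀ x₁ y₀ y₁ :=
  fun _ hz => ⟨(convex_rect _ _ _ _).segment_subset hxZ.1 hyZ.1 hz, fun w hzw =>
    (mem_cell_of_mem_segment u.2 hx hy hz hzw).elim (hxZ.2 w) (hyZ.2 w)⟩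

lemma GeneralPosition.exists_mem_redRegion_of_mem_side (h : GeneralPosition η x₀ x₁ y₀ y₁)
    {ω : Colouring η} {u : η} (hu : ω u = true) {p : Plane} (hp : p ∈ rect x₀ x₁ y₀ y₁)
    (hp0 : p 0 = x₀ ∨ p 0 = x₁) (hpu : p ∈ cell η u) :
    ∃ z ∈ redRegion η ω x₀ x₁ y₀ y₁, z 0 = p 0 ∧ z ∈ cell η u := by
  obtain ⟨z, hz, hz0, hnz⟩ := h.exists_nuclei_eq_singleton hp hp0 ⟨u.2, hpu⟩
  refine ⟨z, ⟨hz, fun w hw => ?_⟩, hz0, (hnz.ge rfl).2⟩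
  rwa [Subtype.ext (hnz.le ⟨w.2, hw⟩ : w.1 = u)]

lemma GeneralPosition.exists_mem_redRegion_of_adj (h : GeneralPosition η x₀ x₁ y₀ y₁)
    {ω : Colouring η} {u v : cellsIn η x₀ x₁ y₀ y₁} (hu : ω u = true) (hv : ω v = true)
    (huv : (cellGraph η x₀ x₁ y₀ y₁).Adj u v) :
    ∃ z ∈ redRegion η ω x₀ x₁ y₀ y₁, z ∈ cell η u ∧ z ∈ cell η v := by
  obtain ⟨hne, p, ⟨hpu, hpv⟩, hp⟩ := huv
  obtain ⟨z, hz, hnz⟩ := h.exists_nuclei_eq_pair hp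
    (Subtype.coe_injective.ne (Subtype.coe_injective.ne hne)) ⟨u.1.2, hpu⟩ ⟨v.1.2, hpv⟩
  refine ⟨z, ⟨hz, fun w hw => ?_⟩, (hnz.ge (Or.inl rfl)).2, (hnz.ge (Or.inr rfl)).2⟩
  obtain hwu | hwv := hnz.le ⟨w.2, hw⟩
  · rwa [Subtype.ext hwu]
  · rwa [Subtype.ext hwv]

lemma LocFinite.noCrossing_of_mem_redCrossing (h : LocFinite η) (hx : x₀ ≤ x₁) (hy : y₀ ≤ y₁)
    {ω : Colouring η} (hω : ω ∈ redCrossing η x₀ x₁ y₀ y₁) :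
    (h.crossingSystem hx hy).NoCrossing Set.univ false
      ((cellsIn η x₀ x₁ y₀ y₁).domRestrict ω) := by
  rintro _ ⟨⟨δ, hδ, rfl⟩, -, hblue⟩
  obtain ⟨γ, hγ, hred⟩ := hω
  obtain ⟨s, t, hst⟩ := exists_eq_of_crossings hγ hδ
  obtain ⟨u, hu, hsu⟩ := h.nuclei_nonempty (γ s)
  have hu_red : ω ⟨u, hu⟩ = true := hred ⟨u, hu⟩ ⟨s, hsu⟩
  have hu_blue : ω ⟨u, hu⟩ = false := hblue ⟨⟨u, hu⟩, γ s, hsu, hγ.1 s⟩ ⟨t, hst ▸ hsu⟩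
  exact Bool.false_ne_true (hu_blue.symm.trans hu_red)

lemma GeneralPosition.mem_redCrossing_of_noCrossing (h : GeneralPosition η x₀ x₁ y₀ y₁)
    (hx : x₀ ≤ x₁) (hy : y₀ ≤ y₁) {ω : Colouring η}
    (hno : (h.crossingSystem hx hy).NoCrossing Set.univ false
      ((cellsIn η x₀ x₁ y₀ y₁).domRestrict ω)) :
    ω ∈ redCrossing η x₀ x₁ y₀ y₁ := by
  set blue : Set (cellsIn η x₀ x₁ y₀ y₁) := {v | ω v = false}
  have hred {v} (hv : v ∈ blueᶜ) : ω v = true := Bool.eq_true_of_not_eq_false hv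
  have hsep : ¬ Separates (cellGraph η x₀ x₁ y₀ y₁) (cellsOnLine η x₀ x₁ y₀ y₁ x₀)
      (cellsOnLine η x₀ x₁ y₀ y₁ x₁) blue := fun hS => by
    obtain ⟨δ, hδ, hblue⟩ := (h.crossingSystem hx hy).separates_iff.1 hS
    exact hno δ ⟨hδ, Set.subset_univ _, fun v hv => hblue hv⟩
  simp only [Separates, not_forall, not_not] at hsep
  obtain ⟨v, ⟨p, hp, hp0, hpv⟩, hchain⟩ := hsep
  obtain ⟨x, hxZ, hx0, hxv⟩ :=
    h.exists_mem_redRegion_of_mem_side (hred hchain.mem) hp (Or.inl hp0) hpv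
  obtain ⟨y, hy1, hxy⟩ := hchain.exists_joinedIn
    (D := fun v : cellsIn η x₀ x₁ y₀ y₁ => cell η v ∩ redRegion η ω x₀ x₁ y₀ y₁)
    (R := {y | y 0 = x₁})
    (fun v _ x hx y hy => JoinedIn.of_segment_subset
      (segment_subset_redRegion hx.1 hy.1 hx.2 hy.2))
    (fun v hv w hw hvw =>
      let ⟨z, hz, hzv, hzw⟩ := h.exists_mem_redRegion_of_adj (hred hv) (hred hw) hvw
      ⟨z, ⟨hzv, hz⟩, hzw, hz⟩)
    (fun v hv ⟨p, hp, hp1, hpv⟩ =>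
      let ⟨z, hz, hz0, hzv⟩ := h.exists_mem_redRegion_of_mem_side (hred hv) hp (Or.inr hp1) hpv
      ⟨z, ⟨hzv, hz⟩, hz0.trans hp1⟩)
    x ⟨hxv, hxZ⟩
  exact ⟨hxy.somePath.toContinuousMap, ⟨fun t => (hxy.somePath_mem t).1,
    by simpa [hx0] using hp0, by simpa using hy1⟩, fun u ⟨t, ht⟩ => (hxy.somePath_mem t).2 u ht⟩

lemma GeneralPosition.mem_redCrossing_iff (h : GeneralPosition η x₀ x₁ y₀ y₁) (hx : x₀ ≤ x₁)
    (hy : y₀ ≤ y₁) (ω : Colouring η) :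
    ω ∈ redCrossing η x₀ x₁ y₀ y₁ ↔ (h.crossingSystem hx hy).NoCrossing Set.univ false
      ((cellsIn η x₀ x₁ y₀ y₁).domRestrict ω) :=
  ⟨h.noCrossing_of_mem_redCrossing hx hy, h.mem_redCrossing_of_noCrossing hx hy⟩

end CellSystem

/-! ### Poisson processes are in general position -/

section Poisson

open Filter Topology

variable {Ω : Type*} [MeasurableSpace Ω] {P : Measure Ω} {η : Ω → Set Plane}

lemma IsPoissonProcess.measure_encard_mem (hη : IsPoissonProcess P η) {A : Set Plane}
    (hA : MeasurableSet A) (hA' : volume A < ⊤) (S : Set ℕ∞) :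
    P {w | (η w ∩ A).encard ∈ S} =
      poissonMeasure (volume A).toNNReal {k : ℕ | (k : ℕ∞) ∈ S} := by
  have hS : MeasurableSet S := S.to_countable.measurableSet
  have hcount := Measure.map_apply (μ := P) (hη.measurable_count A hA hA') hS
  rw [hη.law_count A hA hA', Measure.map_apply (by fun_prop) hS] at hcount
  exact hcount.symm

lemma IsPoissonProcess.measure_inter_eq_empty (hη : IsPoissonProcess P η) {A : Set Plane}
    (hA : MeasurableSet A) (hA' : volume A < ⊤) :
    P {w | η w ∩ A = ∅} = ENNReal.ofReal (Real.exp (-(volume A).toReal)) := by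
  have h := hη.measure_encard_mem hA hA' {0}
  have hzero : {k : ℕ | (k : ℕ∞) ∈ ({0} : Set ℕ∞)} = {0} := by ext; simp
  rw [hzero, poissonMeasure_singleton] at h
  simpa [ENNReal.coe_toNNReal_eq_toReal] using h

lemma IsPoissonProcess.measure_inter_nonempty_le (hη : IsPoissonProcess P η) {A : Set Plane}
    (hA : MeasurableSet A) (hA' : volume A < ⊤) :
    P {w | (η w ∩ A).Nonempty} ≤ volume A := by
  have h := hη.measure_encard_mem hA hA' {0}ᶜ
  have hcompl : {k : ℕ | (k : ℕ∞) ∈ ({0}ᶜ : Set ℕ∞)} = {0}ᶜ := by ext; simp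
  rw [hcompl, prob_compl_eq_one_sub (measurableSet_singleton 0), poissonMeasure_singleton] at h
  simp only [Set.mem_compl_iff, Set.mem_singleton_iff, Set.encard_eq_zero,
    ← Set.nonempty_iff_ne_empty, pow_zero, mul_one, Nat.factorial_zero, Nat.cast_one, div_one,
    ENNReal.coe_toNNReal_eq_toReal] at h
  rw [h, tsub_le_iff_right]
  calc (1 : ENNReal)
      ≤ ENNReal.ofReal ((volume A).toReal + Real.exp (-(volume A).toReal)) := by
        rw [ENNReal.one_le_ofReal]
        linarith [Real.add_one_le_exp (-(volume A).toReal)]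
    _ = volume A + ENNReal.ofReal (Real.exp (-(volume A).toReal)) := by
        rw [ENNReal.ofReal_add ENNReal.toReal_nonneg (Real.exp_nonneg _),
          ENNReal.ofReal_toReal hA'.ne]

lemma IsPoissonProcess.ae_nonempty (hη : IsPoissonProcess P η) :
    ∀ᵐ w ∂P, (η w).Nonempty := by
  have hvol (n : ℕ) :
      (volume (Metric.closedBall (0 : Plane) n)).toReal = Real.pi * (n : ℝ) ^ 2 := by
    rw [EuclideanSpace.volume_closedBall_fin_two, ENNReal.toReal_mul, ENNReal.toReal_pow,
      ENNReal.toReal_ofReal n.cast_nonneg, ENNReal.toReal_ofReal Real.pi_pos.le, mul_comm]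
  have hbound (n : ℕ) :
      P {w | ¬ (η w).Nonempty} ≤ ENNReal.ofReal (Real.exp (-(Real.pi * (n : ℝ) ^ 2))) := by
    rw [← hvol, ← hη.measure_inter_eq_empty Metric.isClosed_closedBall.measurableSet
      measure_closedBall_lt_top]
    refine measure_mono fun w hw => ?_
    rw [Set.mem_ofPred_eq, Set.not_nonempty_iff_eq_empty.1 hw, Set.empty_inter]
  have hlim : Tendsto (fun n : ℕ => ENNReal.ofReal (Real.exp (-(Real.pi * (n : ℝ) ^ 2)))) atTop
      (𝓝 0) := by
    rw [← ENNReal.ofReal_zero]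
    refine ENNReal.tendsto_ofReal (Real.tendsto_exp_neg_atTop_nhds_zero.comp ?_)
    exact ((tendsto_pow_atTop two_ne_zero).comp
      tendsto_natCast_atTop_atTop).const_mul_atTop Real.pi_pos
  exact le_antisymm (ge_of_tendsto' hlim hbound) zero_le

lemma IsPoissonProcess.ae_finite_inter (hη : IsPoissonProcess P η) {A : Set Plane}
    (hA : MeasurableSet A) (hA' : volume A < ⊤) : ∀ᵐ w ∂P, (η w ∩ A).Finite := by
  have h := hη.measure_encard_mem hA hA' {⊤}
  have htop : {k : ℕ | (k : ℕ∞) ∈ ({⊤} : Set ℕ∞)} = ∅ := by ext; simp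
  rw [htop, measure_empty] at h
  exact measure_mono_null (fun w hw => Set.encard_eq_top_iff.2 hw) h

lemma IsPoissonProcess.ae_locFinite (hη : IsPoissonProcess P η) :
    ∀ᵐ w ∂P, LocFinite (η w) := by
  have hfinite : ∀ᵐ w ∂P, ∀ n : ℕ, (η w ∩ Metric.closedBall 0 n).Finite :=
    ae_all_iff.2 fun n =>
      hη.ae_finite_inter Metric.isClosed_closedBall.measurableSet measure_closedBall_lt_top
  filter_upwards [hη.ae_nonempty, hfinite] with w hne hfin
  refine ⟨hne, fun B hB => ?_⟩
  obtain ⟨r, hr⟩ := hB.subset_closedBall 0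
  obtain ⟨n, hn⟩ := exists_nat_ge r
  exact (hfin n).subset (Set.inter_subset_inter_right _
    (hr.trans (Metric.closedBall_subset_closedBall hn)))

lemma IsPoissonProcess.measure_forall_inter_nonempty_le (hη : IsPoissonProcess P η) {k : ℕ}
    {A : Fin k → Set Plane} (hA : ∀ i, MeasurableSet (A i))
    (hA' : ∀ i, volume (A i) < ⊤) (hdisj : Pairwise fun i j => Disjoint (A i) (A j)) :
    P {w | ∀ i, (η w ∩ A i).Nonempty} ≤ volume (Set.univ.pi A) := by
  have hinter : {w | ∀ i, (η w ∩ A i).Nonempty} =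
      ⋂ i ∈ (Finset.univ : Finset (Fin k)), (fun w => (η w ∩ A i).encard) ⁻¹' {0}ᶜ := by
    ext w; simp [Set.nonempty_iff_ne_empty]
  rw [hinter, (hη.indep_count k A hA hA' hdisj).measure_inter_preimage_eq_mul Finset.univ
    fun _ _ => (Set.to_countable {0}ᶜ).measurableSet, volume_pi_pi]
  refine Finset.prod_le_prod' fun i _ => (measure_mono fun w hw => ?_).trans
    (hη.measure_inter_nonempty_le (hA i) (hA' i))
  exact Set.encard_ne_zero.1 hw

lemma IsPoissonProcess.measure_exists_tuple_le (hη : IsPoissonProcess P η) {ι : Type*}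
    [Countable ι] [MeasurableSpace ι] [MeasurableSingletonClass ι] {g : Plane → ι}
    (hg : Measurable g) {ε : ℝ} (hε : 0 ≤ ε) (hdiam : ∀ p q, g p = g q → dist p q ≤ ε)
    {k : ℕ} {N : Set (Fin k → Plane)} (hsep : ∀ t ∈ N, ∀ i j, i ≠ j → ε < dist (t i) (t j)) :
    P {w | ∃ t ∈ N, ∀ i, t i ∈ η w} ≤ volume (Metric.cthickening ε N) := by
  set part : (Fin k → ι) → Set (Fin k → Plane) := fun z => Set.univ.pi fun i => g ⁻¹' {z i}
  set Z : Set (Fin k → ι) := (fun t i => g (t i)) '' N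
  have hmem (z : Fin k → ι) (t : Fin k → Plane) : t ∈ part z ↔ ∀ i, g (t i) = z i := by
    simp [part]
  have hmeas (c : ι) : MeasurableSet (g ⁻¹' {c}) := hg (measurableSet_singleton c)
  have hfin (c : ι) : volume (g ⁻¹' {c}) < ⊤ :=
    (Metric.isBounded_iff.2 ⟨ε, fun p hp q hq => hdiam p q (hp.trans hq.symm)⟩).measure_lt_top
  have hdisj : ∀ z ∈ Z, Pairwise fun i j => Disjoint (g ⁻¹' {z i}) (g ⁻¹' {z j}) := by
    rintro _ ⟨t, ht, rfl⟩ i j hij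
    exact Disjoint.preimage g (Set.disjoint_singleton.2 fun h =>
      (hsep t ht i j hij).not_ge (hdiam _ _ h))
  calc P {w | ∃ t ∈ N, ∀ i, t i ∈ η w}
      ≤ P (⋃ z ∈ Z, {w | ∀ i, (η w ∩ g ⁻¹' {z i}).Nonempty}) := by
        refine measure_mono ?_
        rintro w ⟨t, ht, hw⟩
        exact Set.mem_biUnion (Set.mem_image_of_mem _ ht) fun i => ⟨t i, hw i, rfl⟩
    _ ≤ ∑' z : Z, P {w | ∀ i, (η w ∩ g ⁻¹' {z.1 i}).Nonempty} :=
        measure_biUnion_le _ Z.to_countable _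
    _ ≤ ∑' z : Z, volume (part z) := ENNReal.tsum_le_tsum fun z =>
        hη.measure_forall_inter_nonempty_le (fun i => hmeas _) (fun i => hfin _) (hdisj z z.2)
    _ = volume (⋃ z ∈ Z, part z) := by
        refine (measure_biUnion Z.to_countable (fun z _ z' _ hne => ?_)
          fun z _ => MeasurableSet.univ_pi fun i => hmeas (z i)).symm
        refine Set.disjoint_left.2 fun t ht ht' => hne (funext fun i => ?_)
        exact ((hmem z t).1 ht i).symm.trans ((hmem z' t).1 ht' i)
    _ ≤ volume (Metric.cthickening ε N) := by
        refine measure_mono (Set.iUnion₂_subset ?_)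
        rintro _ ⟨t, ht, rfl⟩ s hs
        refine Metric.mem_cthickening_of_dist_le s t _ _ ht ((dist_pi_le_iff hε).2 fun i => ?_)
        exact hdiam _ _ ((hmem _ s).1 hs i)

/-- The index of the square of the grid of mesh `1 / (n + 1)` that contains `p`. -/
noncomputable def gridIndex (n : ℕ) (p : Plane) : Fin 2 → ℤ := fun i => ⌊((n : ℝ) + 1) * p i⌋

lemma measurable_gridIndex (n : ℕ) : Measurable (gridIndex n) :=
  measurable_pi_lambda _ fun i => by unfold gridIndex; fun_prop

lemma dist_le_of_gridIndex_eq {n : ℕ} {p q : Plane} (h : gridIndex n p = gridIndex n q) :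
    dist p q ≤ 2 * (1 / ((n : ℝ) + 1)) := by
  have hn : (0 : ℝ) < n + 1 := by positivity
  have hcoord (i : Fin 2) : ‖(p - q) i‖ ≤ 1 / ((n : ℝ) + 1) := by
    have := Int.abs_sub_lt_one_of_floor_eq_floor (congrFun h i)
    rw [← mul_sub, abs_mul, abs_of_pos hn] at this
    rw [le_div_iff₀' hn]
    exact this.le
  calc dist p q = ‖p - q‖ := dist_eq_norm p q
    _ ≤ ∑ i, ‖(p - q) i‖ := by
        conv_lhs => rw [← (EuclideanSpace.basisFun (Fin 2) ℝ).sum_repr (p - q)]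
        refine (norm_sum_le _ _).trans_eq (Finset.sum_congr rfl fun i _ => ?_)
        rw [norm_smul, (EuclideanSpace.basisFun (Fin 2) ℝ).norm_eq_one, mul_one,
          EuclideanSpace.basisFun_repr]
    _ ≤ 2 * (1 / ((n : ℝ) + 1)) := by
        rw [Fin.sum_univ_two, two_mul]
        exact add_le_add (hcoord 0) (hcoord 1)

lemma IsPoissonProcess.ae_notMem_of_isCompact (hη : IsPoissonProcess P η) {k : ℕ}
    {K : Set (Fin k → Plane)} (hK : IsCompact K)
    (hinj : ∀ t ∈ K, Function.Injective t) (hnull : volume K = 0) :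
    ∀ᵐ w ∂P, ∀ t ∈ K, ¬ ∀ i, t i ∈ η w := by
  obtain ⟨δ, hδ, hsep⟩ : ∃ δ > 0, ∀ t ∈ K, ∀ i j, i ≠ j → δ ≤ dist (t i) (t j) := by
    have hpair (i j : Fin k) : ∀ᶠ δ in 𝓝[>] (0 : ℝ), ∀ t ∈ K, i ≠ j → δ ≤ dist (t i) (t j) := by
      by_cases hij : i = j
      · exact .of_forall fun δ t _ hne => absurd hij hne
      obtain ⟨δ, hδ, hle⟩ := hK.exists_forall_le' (f := fun t => dist (t i) (t j)) (a := 0)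
        (by fun_prop) fun t ht => dist_pos.2 fun h => hij (hinj t ht h)
      filter_upwards [Ioc_mem_nhdsGT hδ] with ε hε t ht _ using hε.2.trans (hle t ht)
    obtain ⟨δ, hle, hδ⟩ := ((eventually_all.2 fun i => eventually_all.2 (hpair i)).and
      self_mem_nhdsWithin).exists
    exact ⟨δ, hδ, fun t ht i j => hle i j t ht⟩
  have hmesh : Tendsto (fun n : ℕ => 2 * (1 / ((n : ℝ) + 1))) atTop (𝓝 0) := by
    simpa only [mul_zero] using (tendsto_one_div_add_atTop_nhds_zero_nat (𝕜 := ℝ)).const_mul 2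
  have hlim := (tendsto_measure_cthickening_of_isCompact (μ := volume) hK).comp hmesh
  rw [hnull] at hlim
  have hzero : P {w | ∃ t ∈ K, ∀ i, t i ∈ η w} = 0 := by
    refine le_antisymm (ge_of_tendsto hlim ?_) zero_le
    filter_upwards [hmesh.eventually_lt_const hδ] with n hn
    exact hη.measure_exists_tuple_le (measurable_gridIndex n) (by positivity)
      (fun _ _ => dist_le_of_gridIndex_eq) fun t ht i j hij => hn.trans_le (hsep t ht i j hij)
  rw [ae_iff]
  simpa using hzero

theorem IsPoissonProcess.ae_notMem (hη : IsPoissonProcess P η) {k : ℕ}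
    {N : Set (Fin k → Plane)} (hN : IsSigmaCompact N) (hinj : ∀ t ∈ N, Function.Injective t)
    (hnull : volume N = 0) : ∀ᵐ w ∂P, ∀ t ∈ N, ¬ ∀ i, t i ∈ η w := by
  obtain ⟨K, hK, rfl⟩ := hN
  filter_upwards [ae_all_iff.2 fun n => hη.ae_notMem_of_isCompact (hK n)
    (fun t ht => hinj t (Set.mem_iUnion_of_mem n ht))
    (measure_mono_null (Set.subset_iUnion K n) hnull)] with w hw t ht
  obtain ⟨n, hn⟩ := Set.mem_iUnion.1 ht
  exact hw n t hn

end Poisson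

section Equidistant

variable {Ω : Type*} [MeasurableSpace Ω] {P : Measure Ω} {η : Ω → Set Plane}

lemma isSigmaCompact_of_isLocallyClosed {X : Type*} [TopologicalSpace X] [T2Space X]
    [LocallyCompactSpace X] [SecondCountableTopology X] {s : Set X} (hs : IsLocallyClosed s) :
    IsSigmaCompact s :=
  have := hs.locallyCompactSpace
  isSigmaCompact_iff_sigmaCompactSpace.2 inferInstance

lemma measurableSet_of_isSigmaCompact {X : Type*} [TopologicalSpace X] [T2Space X]
    [MeasurableSpace X] [OpensMeasurableSpace X] {s : Set X} (hs : IsSigmaCompact s) :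
    MeasurableSet s := by
  obtain ⟨K, hK, rfl⟩ := hs
  exact .iUnion fun n => (hK n).measurableSet

lemma isOpen_setOf_injective {ι X : Type*} [Finite ι] [TopologicalSpace X] [T2Space X] :
    IsOpen {t : ι → X | Function.Injective t} := by
  simp only [Function.Injective, Set.ofPred_forall]
  refine isOpen_iInter_of_finite fun i => isOpen_iInter_of_finite fun j => ?_
  by_cases hij : i = j
  · simp [hij]
  · simpa [hij] using isOpen_ne_fun (f := fun t : ι → X => t i) (g := fun t => t j)
      (by fun_prop) (by fun_prop)

lemma volume_eq_zero_of_fibres {X : Type*} [MeasureSpace X] [SigmaFinite (volume : Measure X)]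
    {k : ℕ} {N : Set (Fin (k + 1) → X)} (hN : MeasurableSet N)
    (h : ∀ f : Fin k → X, volume {x : X | (Fin.cons x f : Fin (k + 1) → X) ∈ N} = 0) :
    volume N = 0 := by
  have hpres := (volume_preserving_piFinSuccAbove (fun _ : Fin (k + 1) => X) 0).symm
  rw [← hpres.measure_preimage hN.nullMeasurableSet, Measure.volume_eq_prod,
    Measure.prod_apply_symm (hpres.measurable hN)]
  refine (lintegral_congr fun f => ?_).trans lintegral_zero
  rw [← h f]
  congr 1
  ext x
  simp [MeasurableEquiv.piFinSuccAbove, Fin.insertNthEquiv]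

lemma volume_coord_eq {ι : Type*} [Fintype ι] (i : ι) (c : ℝ) :
    volume {x : EuclideanSpace ℝ ι | x i = c} = 0 := by
  have hmeas : MeasurableSet {f : ι → ℝ | f i = c} :=
    measurableSet_eq_fun (by fun_prop) (by fun_prop)
  have hplane : volume {f : ι → ℝ | f i = c} = 0 :=
    Measure.pi_hyperplane (fun _ : ι => (volume : Measure ℝ)) i c
  exact ((EuclideanSpace.volume_preserving_symm_measurableEquiv_toLp ι).measure_preimage
    hmeas.nullMeasurableSet).trans hplane

lemma IsPoissonProcess.ae_injOn_coord (hη : IsPoissonProcess P η) (i : Fin 2) :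
    ∀ᵐ w ∂P, Set.InjOn (fun u : Plane => u i) (η w) := by
  have hcompact : IsSigmaCompact
      ({t : Fin 2 → Plane | Function.Injective t} ∩ {t | t 0 i = t 1 i}) :=
    isSigmaCompact_of_isLocallyClosed <| isOpen_setOf_injective.isLocallyClosed.inter
      (isClosed_eq (by fun_prop) (by fun_prop)).isLocallyClosed
  have hnull := volume_eq_zero_of_fibres (measurableSet_of_isSigmaCompact hcompact) fun f =>
    measure_mono_null (fun x hx => by simpa using hx.2) (volume_coord_eq i (f 0 i))
  filter_upwards [hη.ae_notMem hcompact (fun t ht => ht.1) hnull] with w hw u hu v hv huv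
  by_contra hne
  refine hw ![u, v] ⟨?_, huv⟩ (Fin.forall_fin_two.2 ⟨hu, hv⟩)
  intro i j
  fin_cases i <;> fin_cases j <;> simp [hne, Ne.symm hne]

/-- The injective tuples whose points are equidistant from a point of `C` and whose tail lies in
`Φ`. In the applications a tail in `Φ` determines the centre, so that the head is confined to a
circle and the set is null. -/
def equidistantTuples (C : Set Plane) {k : ℕ} (Φ : Set (Fin (k + 1) → Plane)) :
    Set (Fin (k + 2) → Plane) :=
  {t | Function.Injective t ∧ Fin.tail t ∈ Φ ∧ ∃ p ∈ C, ∀ i, dist (t i) p = dist (t 0) p}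

lemma isSigmaCompact_equidistantTuples {C : Set Plane} (hC : IsClosed C) {k : ℕ}
    {Φ : Set (Fin (k + 1) → Plane)} (hΦ : IsOpen Φ) :
    IsSigmaCompact (equidistantTuples C Φ) := by
  have hopen : IsOpen {z : Plane × (Fin (k + 2) → Plane) |
      Function.Injective z.2 ∧ Fin.tail z.2 ∈ Φ} :=
    (isOpen_setOf_injective.preimage continuous_snd).inter
      (hΦ.preimage (by unfold Fin.tail; fun_prop))
  have hclosed : IsClosed {z : Plane × (Fin (k + 2) → Plane) |
      z.1 ∈ C ∧ ∀ i, dist (z.2 i) z.1 = dist (z.2 0) z.1} := by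
    simp only [Set.ofPred_and, Set.ofPred_forall]
    exact (hC.preimage continuous_fst).inter
      (isClosed_iInter fun i => isClosed_eq (by fun_prop) (by fun_prop))
  convert! (isSigmaCompact_of_isLocallyClosed
    (hopen.isLocallyClosed.inter hclosed.isLocallyClosed)).image continuous_snd using 1
  ext t
  simp [equidistantTuples, and_assoc]

lemma volume_equidistantTuples {C : Set Plane} (hC : IsClosed C) {k : ℕ}
    {Φ : Set (Fin (k + 1) → Plane)} (hΦ : IsOpen Φ)
    (huniq : ∀ f ∈ Φ, ∀ p ∈ C, ∀ q ∈ C, (∀ i, dist (f i) p = dist (f 0) p) →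
      (∀ i, dist (f i) q = dist (f 0) q) → p = q) :
    volume (equidistantTuples C Φ) = 0 := by
  refine volume_eq_zero_of_fibres
    (measurableSet_of_isSigmaCompact (isSigmaCompact_equidistantTuples hC hΦ)) fun f => ?_
  obtain hempty | ⟨x, -, hxΦ, p, hp, hx⟩ := Set.eq_empty_or_nonempty
    {x : Plane | (Fin.cons x f : Fin (k + 2) → Plane) ∈ equidistantTuples C Φ}
  · rw [hempty, measure_empty]
  · refine measure_mono_null ?_ (Measure.addHaar_sphere volume p (dist (f 0) p))
    rintro y ⟨-, -, q, hq, hy⟩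
    simp only [Fin.forall_fin_succ (n := k + 1), Fin.cons_zero, Fin.cons_succ] at hx hy
    obtain rfl : p = q := huniq f (by simpa using hxΦ) p hp q hq
      (fun i => (hx.2 i).trans (hx.2 0).symm) (fun i => (hy.2 i).trans (hy.2 0).symm)
    exact (hy.2 0).symm

lemma IsPoissonProcess.ae_encard_inter_sphere_le (hη : IsPoissonProcess P η) {C : Set Plane}
    (hC : IsClosed C) {k : ℕ} {Φ : Set (Fin (k + 1) → Plane)} (hΦ : IsOpen Φ)
    (huniq : ∀ f ∈ Φ, ∀ p ∈ C, ∀ q ∈ C, (∀ i, dist (f i) p = dist (f 0) p) →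
      (∀ i, dist (f i) q = dist (f 0) q) → p = q)
    (hmem : ∀ᵐ w ∂P, ∀ p r, ∀ f : Fin (k + 1) → Plane, Function.Injective f →
      (∀ i, f i ∈ η w ∩ Metric.sphere p r) → f ∈ Φ) :
    ∀ᵐ w ∂P, ∀ p ∈ C, ∀ r, (η w ∩ Metric.sphere p r).encard ≤ k + 1 := by
  filter_upwards [hmem, hη.ae_notMem (isSigmaCompact_equidistantTuples hC hΦ) (fun t ht => ht.1)
    (volume_equidistantTuples hC hΦ huniq)] with w hwΦ hw p hp r
  by_contra! hlt
  obtain ⟨F, hF, hFcard⟩ := Set.exists_subset_encard_eq (Order.add_one_le_of_lt hlt)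
  have hFfin : F.Finite := Set.finite_of_encard_eq_coe (k := k + 2) (by rw [hFcard]; rfl)
  have := hFfin.to_subtype
  have hcard : Nat.card F = k + 2 := by
    rw [Nat.card_coe_set_eq, Set.ncard, hFcard]; rfl
  let e : Fin (k + 2) ≃ F := (Finite.equivFinOfCardEq hcard).symm
  have hinj : Function.Injective fun i => (e i : Plane) := Subtype.val_injective.comp e.injective
  have hsphere (i : Fin (k + 2)) := hF (e i).2
  refine hw (fun i => e i) ⟨hinj, hwΦ p r _ (hinj.comp (Fin.succ_injective _))
    fun i => hsphere i.succ, p, hp, fun i => ?_⟩ fun i => (hsphere i).1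
  exact (hsphere i).2.trans (hsphere 0).2.symm

end Equidistant

section GeneralPosition

open EuclideanGeometry

variable {Ω : Type*} [MeasurableSpace Ω] {P : Measure Ω} {η : Ω → Set Plane}

lemma IsPoissonProcess.ae_encard_inter_sphere_le_three (hη : IsPoissonProcess P η) :
    ∀ᵐ w ∂P, ∀ p r, (η w ∩ Metric.sphere p r).encard ≤ 3 := by
  have huniq : ∀ f ∈ {f : Fin 3 → Plane | AffineIndependent ℝ f}, ∀ p ∈ Set.univ, ∀ q ∈ Set.univ,
      (∀ i, dist (f i) p = dist (f 0) p) → (∀ i, dist (f i) q = dist (f 0) q) → p = q := by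
    intro f hf p _ q _ hp hq
    have hspan : affineSpan ℝ (Set.range f) = ⊤ :=
      hf.affineSpan_eq_top_iff_card_eq_finrank_add_one.2 (by simp)
    let s : Affine.Simplex ℝ Plane 2 := ⟨f, hf⟩
    have hmem (x : Plane) : x ∈ affineSpan ℝ (Set.range s.points) :=
      hspan ▸ AffineSubspace.mem_top ..
    rw [s.eq_circumcenter_of_dist_eq (hmem p) hp, s.eq_circumcenter_of_dist_eq (hmem q) hq]
  filter_upwards [hη.ae_encard_inter_sphere_le isClosed_univ
    isOpen_setOfPred_affineIndependent huniq (.of_forall fun w p r f hinj hf =>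
      Cospherical.affineIndependent ⟨p, r, fun x hx => hx.2⟩ (Set.range_subset_iff.2 hf) hinj)]
    with w hw p r
  exact hw p trivial r

lemma IsPoissonProcess.ae_encard_inter_sphere_le_two (hη : IsPoissonProcess P η) (i : Fin 2)
    (s : ℝ) : ∀ᵐ w ∂P, ∀ p : Plane, p i = s → ∀ r, (η w ∩ Metric.sphere p r).encard ≤ 2 := by
  have hopen : IsOpen {f : Fin 2 → Plane | f 0 (1 - i) ≠ f 1 (1 - i)} :=
    isOpen_ne_fun (by fun_prop) (by fun_prop)
  have huniq : ∀ f ∈ {f : Fin 2 → Plane | f 0 (1 - i) ≠ f 1 (1 - i)}, ∀ p ∈ {p : Plane | p i = s},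
      ∀ q ∈ {p : Plane | p i = s}, (∀ j, dist (f j) p = dist (f 0) p) →
      (∀ j, dist (f j) q = dist (f 0) q) → p = q := by
    intro f hf p hp q hq hfp hfq
    have hpq : p i = q i := hp.trans hq.symm
    have horth := inner_vsub_vsub_of_dist_eq_of_dist_eq (hfp 1) (hfq 1)
    simp only [vsub_eq_sub, PiLp.inner_apply, Fin.sum_univ_two, PiLp.sub_apply, RCLike.inner_apply,
      conj_trivial] at horth
    have hne : f 0 (1 - i) - f 1 (1 - i) ≠ 0 := sub_ne_zero.2 hf
    have hpq' : p (1 - i) = q (1 - i) := by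
      refine mul_left_cancel₀ hne ?_
      fin_cases i <;> simp_all <;> linarith
    ext j
    fin_cases i <;> fin_cases j <;> assumption
  refine hη.ae_encard_inter_sphere_le (isClosed_eq (by fun_prop) continuous_const) hopen huniq ?_
  filter_upwards [hη.ae_injOn_coord (1 - i)] with w hw p r f hinj hf heq
  exact zero_ne_one (hinj (hw (hf 0).1 (hf 1).1 heq))

lemma IsPoissonProcess.ae_encard_inter_sphere_le_one (hη : IsPoissonProcess P η) (p : Plane) :
    ∀ᵐ w ∂P, ∀ r, (η w ∩ Metric.sphere p r).encard ≤ 1 := by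
  filter_upwards [hη.ae_encard_inter_sphere_le (k := 0) isClosed_singleton isOpen_univ
    (fun f _ q hq q' hq' _ _ => hq.trans hq'.symm) (.of_forall fun _ _ _ _ _ _ => trivial)]
    with w hw r
  simpa using hw p rfl r

theorem IsPoissonProcess.ae_generalPosition (hη : IsPoissonProcess P η) (x₀ x₁ y₀ y₁ : ℝ) :
    ∀ᵐ w ∂P, GeneralPosition (η w) x₀ x₁ y₀ y₁ := by
  have hcorners : ∀ᵐ w ∂P, ∀ a ∈ ({x₀, x₁} : Set ℝ), ∀ b ∈ ({y₀, y₁} : Set ℝ), ∀ r,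
      (η w ∩ Metric.sphere !₂[a, b] r).encard ≤ 1 :=
    (ae_ball_iff (Set.to_countable _)).2 fun a _ => (ae_ball_iff (Set.to_countable _)).2 fun b _ =>
      hη.ae_encard_inter_sphere_le_one _
  have hsides (i : Fin 2) (a b : ℝ) : ∀ᵐ w ∂P, ∀ p : Plane, p i = a ∨ p i = b → ∀ r,
      (η w ∩ Metric.sphere p r).encard ≤ 2 := by
    filter_upwards [hη.ae_encard_inter_sphere_le_two i a, hη.ae_encard_inter_sphere_le_two i b]
      with w ha hb p hp using hp.elim (ha p) (hb p)
  have hnuclei {σ : Set Plane} {p : Plane} {k : ℕ∞}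
      (h : ∀ r, (σ ∩ Metric.sphere p r).encard ≤ k) : (nuclei σ p).encard ≤ k := by
    obtain ⟨r, hr⟩ := exists_nuclei_subset_sphere σ p
    exact (Set.encard_le_encard hr).trans (h r)
  filter_upwards [hη.ae_locFinite, hη.ae_encard_inter_sphere_le_three, hsides 0 x₀ x₁,
    hsides 1 y₀ y₁, hcorners, hη.ae_injOn_coord 1] with w hfin hthree hvert hhor hone hinj
  refine ⟨hfin, fun p => hnuclei (hthree p),
    fun p hp => hnuclei (hp.elim (hvert p) (hhor p)), fun p hp0 hp1 => hnuclei ?_, hinj⟩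
  have hp : p = !₂[p 0, p 1] := by ext i; fin_cases i <;> rfl
  exact hp ▸ hone (p 0) hp0 (p 1) hp1

end GeneralPosition

/-! ### The crossing identity for a point set in general position -/

section Switching

variable {η : Set Plane} {x₀ x₁ y₀ y₁ : ℝ}

lemma map_domRestrict_colourLaw (W : Set η) [Fintype W] :
    (colourLaw η).map W.domRestrict =
      Measure.pi fun _ => (PMF.uniformOfFintype Bool).toMeasure := by
  rw [← Measure.infinitePi_eq_pi]
  exact Measure.infinitePi_map_restrict' (I := W) fun _ => (PMF.uniformOfFintype Bool).toMeasure

lemma integral_comp_domRestrict_colourLaw (W : Set η) [Fintype W] [DecidableEq W]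
    (f : (W → Bool) → ℝ) :
    ∫ ω, f (W.domRestrict ω) ∂colourLaw η = (1 / 2) ^ Fintype.card W * ∑ ω, f ω := by
  rw [← integral_map (by fun_prop) (measurable_of_countable f).aestronglyMeasurable,
    map_domRestrict_colourLaw, integral_fintype .of_finite, Finset.mul_sum]
  refine Finset.sum_congr rfl fun ω _ => ?_
  rw [measureReal_def, Measure.pi_singleton]
  simp

lemma GeneralPosition.redCrossing_eq_preimage (h : GeneralPosition η x₀ x₁ y₀ y₁) (hx : x₀ ≤ x₁)
    (hy : y₀ ≤ y₁) : redCrossing η x₀ x₁ y₀ y₁ = (cellsIn η x₀ x₁ y₀ y₁).domRestrict ⁻¹'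
      {ω | (h.crossingSystem hx hy).NoCrossing Set.univ false ω} :=
  Set.ext (h.mem_redCrossing_iff hx hy)

lemma GeneralPosition.measurableSet_redCrossing (h : GeneralPosition η x₀ x₁ y₀ y₁)
    (hx : x₀ ≤ x₁) (hy : y₀ ≤ y₁) : MeasurableSet (redCrossing η x₀ x₁ y₀ y₁) := by
  have := h.finite_cellsIn (x₀ := x₀) (x₁ := x₁) (y₀ := y₀) (y₁ := y₁)
  have := this.to_subtype
  rw [h.redCrossing_eq_preimage hx hy]
  exact measurableSet_preimage (by fun_prop) (Set.to_countable _).measurableSet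

lemma LocFinite.maxCrossings_eq (h : LocFinite η) (hx : x₀ ≤ x₁) (hy : y₀ ≤ y₁) :
    maxCrossings η x₀ x₁ y₀ y₁ = fun ω =>
      (h.crossingSystem hx hy).maxCount Set.univ ((cellsIn η x₀ x₁ y₀ y₁).domRestrict ω) :=
  funext fun ω => congrArg sSup (h.crossingCounts_eq hx hy ω)

lemma LocFinite.measurable_maxCrossings (h : LocFinite η) (hx : x₀ ≤ x₁) (hy : y₀ ≤ y₁) :
    Measurable (maxCrossings η x₀ x₁ y₀ y₁) := by
  have := (h.finite_cellsIn (x₀ := x₀) (x₁ := x₁) (y₀ := y₀) (y₁ := y₁)).to_subtype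
  rw [h.maxCrossings_eq hx hy]
  exact (measurable_of_countable ((h.crossingSystem hx hy).maxCount Set.univ)).comp (by fun_prop)

lemma LocFinite.isGreatest_maxCrossings (h : LocFinite η) (hx : x₀ ≤ x₁) (hy : y₀ ≤ y₁)
    (ω : Colouring η) :
    IsGreatest (crossingCounts η ω x₀ x₁ y₀ y₁) (maxCrossings η x₀ x₁ y₀ y₁ ω) := by
  have := (h.finite_cellsIn (x₀ := x₀) (x₁ := x₁) (y₀ := y₀) (y₁ := y₁)).to_subtype
  rw [h.crossingCounts_eq hx hy, h.maxCrossings_eq hx hy]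
  exact (h.crossingSystem hx hy).isGreatest_maxCount _ _

theorem GeneralPosition.real_redCrossing_eq_integral (h : GeneralPosition η x₀ x₁ y₀ y₁)
    (hx : x₀ ≤ x₁) (hy : y₀ ≤ y₁) :
    (colourLaw η).real (redCrossing η x₀ x₁ y₀ y₁) =
      ∫ ω, (2 : ℝ) ^ (-(maxCrossings η x₀ x₁ y₀ y₁ ω : ℤ)) ∂colourLaw η := by
  classical
  have := h.finite_cellsIn (x₀ := x₀) (x₁ := x₁) (y₀ := y₀) (y₁ := y₁)
  have := this.fintype
  set W := cellsIn η x₀ x₁ y₀ y₁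
  set G : CrossingSystem W := h.crossingSystem hx hy
  calc (colourLaw η).real (redCrossing η x₀ x₁ y₀ y₁)
      = ∫ ω, {ω | G.NoCrossing Set.univ false ω}.indicator 1 (W.domRestrict ω) ∂colourLaw η := by
        rw [← integral_indicator_one (h.measurableSet_redCrossing hx hy),
          h.redCrossing_eq_preimage hx hy]
        rfl
    _ = (1 / 2) ^ Fintype.card W *
          (Finset.card {ω ∈ Finset.univ | G.NoCrossing Set.univ false ω} : ℝ) := by
        rw [integral_comp_domRestrict_colourLaw]
        simp [Set.indicator_apply, Finset.sum_boole]
    _ = (1 / 2) ^ Fintype.card W * ∑ ω, (1 / 2) ^ G.maxCount Set.univ ω := by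
        rw [G.card_noCrossing_eq_sum]
        simp [DependsOn]
    _ = ∫ ω, (2 : ℝ) ^ (-(maxCrossings η x₀ x₁ y₀ y₁ ω : ℤ)) ∂colourLaw η := by
        rw [← integral_comp_domRestrict_colourLaw, h.maxCrossings_eq hx hy]
        simp only [zpow_neg, zpow_natCast, one_div, inv_pow, W, G]

end Switching

end Voronoi

theorem mainTheorem9 {Ω : Type*} [MeasurableSpace Ω] (P : Measure Ω) [IsProbabilityMeasure P]
    (η : Ω → Set Voronoi.Plane) (hη : Voronoi.IsPoissonProcess P η)
    (x₀ x₁ y₀ y₁ : ℝ) (hx : x₀ < x₁) (hy : y₀ < y₁) :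
    ∀ᵐ w ∂P,
      MeasurableSet (Voronoi.redCrossing (η w) x₀ x₁ y₀ y₁) ∧
      Measurable (Voronoi.maxCrossings (η w) x₀ x₁ y₀ y₁) ∧
      (∀ ω : Voronoi.Colouring (η w),
        IsGreatest (Voronoi.crossingCounts (η w) ω x₀ x₁ y₀ y₁)
          (Voronoi.maxCrossings (η w) x₀ x₁ y₀ y₁ ω)) ∧
      (Voronoi.colourLaw (η w)).real (Voronoi.redCrossing (η w) x₀ x₁ y₀ y₁) =
        ∫ ω, (2 : ℝ) ^ (-(Voronoi.maxCrossings (η w) x₀ x₁ y₀ y₁ ω : ℤ))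
          ∂(Voronoi.colourLaw (η w)) := by
  filter_upwards [hη.ae_generalPosition x₀ x₁ y₀ y₁] with w hw
  exact ⟨hw.measurableSet_redCrossing hx.le hy.le, hw.measurable_maxCrossings hx.le hy.le,
    hw.isGreatest_maxCrossings hx.le hy.le, hw.real_redCrossing_eq_integral hx.le hy.le⟩
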